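/- Let $N\ge 1$, $k\in\mathbb Z_N$, $b\in\mathbb R$ be such that $c_k=\cos(b+\pi k/N)\neq 0$. Let $p_*\ge 1$, put $p=p_*/2$ if $p_*$ is even and $p=p_*$ if $p_*$ is odd, and let $v=(v_n)_{n\in\mathbb Z}$ be a real $p_*$-periodic sequence with $\sum_{n=1}^{2p}v_n=0$. For $t\ge 0$ consider the $2p$-periodic Jacobi operator $$(J_k^b(t)y)_n=a_{n-1}y_{n-1}+a_ny_{n+1}+t\,v_ny_n,\qquad a_{2n}=2|c_k|,\quad a_{2n+1}=1,\quad n\in\mathbb Z,$$ with spectral bands $[z_{k,n-1}^{b,+}(t),z_{k,n}^{b,-}(t)]$, $1\le n\le 2p$, where $$z_{k,0}^{b,+}<z_{k,1}^{b,-}\le z_{k,1}^{b,+}<z_{k,2}^{b,-}\le z_{k,2}^{b,+}<\dots<z_{k,2p}^{b,-}$$ are its $4p$-periodic eigenvalues, that is, the $4p$ eigenvalues, counted with multiplicity and listed in nondecreasing order, of $J_k^b(t)y=zy$ on the space of sequences with $y_{n+4p}=y_n$. Put $\tau_n=e^{i\pi n/p}$ and, for $1\le n\le 2p-1$, $$\hat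 v_n^0=\frac1{2p}\sum_{j=1}^p v_{2j}\,\tau_n^{2j},\qquad \hat v_n^1=\frac1{2p}\sum_{j=1}^p v_{2j+1}\,\tau_n^{2j}.$$ Let $\mathbb N_{k,p}=\{1,\dots,2p-1\}$ if $2|c_k|=1$ and $\mathbb N_{k,p}=\{1,\dots,2p-1\}\setminus\{p\}$ if $2|c_k|\ne1$. Then, as $t\downarrow0$: (1) for all $n\in\mathbb N_{k,p}$, $$z_{k,n}^{b,\pm}(t)=z_{k,n}^{b,\pm}(0)\pm t\,\psi_{k,n}(v)+O(t^2),\qquad \psi_{k,n}(v)=\begin{cases}|\hat v_n^0+e^{2i\arg(2|c_k|+\tau_n)}\hat v_n^1|,& n\ne p,\\ |\hat v_p^0-\hat v_p^1|,& n=p,\ 2|c_k|=1;\end{cases}$$ (2) $z_{k,0}^{b,+}(t)=z_{k,0}^{b,+}(0)+O(t^2)$ and $z_{k,2p}^{b,-}(t)=z_{k,2p}^{b,-}(0)+O(t^2)$; if $2|c_k|\neq1$, then also $z_{k,p}^{b,\pm}(t)=z_{k,p}^{b,\pm}(0)+O(t^2)$; (3) the unperturbed edges are $z_{k,n}^{b,\pm}(0)=\big|2|c_k|+\tau_n\big|\,\mathrm{sign}(n-p)$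 for $1\le n\le 2p-1$, $n\neq p$, and $z_{k,p}^{b,\pm}(0)=\pm\big|2|c_k|-1\big|$. (4) If $p_*$ is odd, then for all $n\in\mathbb N_{k,p}$ $$\hat v_n^0=\tau_n^{p+1}\hat v_n^1,\qquad \psi_{k,n}(v)=|\hat v_n^0|\,\rho_{k,n},\qquad \rho_{k,n}=\begin{cases}|(-1)^n\tau_n+e^{2i\arg(2|c_k|+\tau_n)}|,& n\neq p,\\ 0,& n=p,\ 2|c_k|=1,\end{cases}$$ where $\rho_{k,n}\ne0$ if $|c_k|\neq\frac12$; and if $|c_k|=\frac12$, then $\rho_{k,n}\neq0$ for even $n$ and $\rho_{k,n}=0$ for odd $n$. -/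

import Mathlib

open Filter Topology Asymptotics

noncomputable section

/-- The number `c_k = cos (b + π k / N)`, where `k : ℤ` represents a class in `ℤ / N ℤ`. Another
representative changes `c_k` at most by a sign, and only `|c_k|` enters the operator. -/
def hopping (N : ℕ) (k : ℤ) (b : ℝ) : ℝ := Real.cos (b + Real.pi * k / N)

/-- Off-diagonal coefficients: `a_n = 2 |c|` for even `n` and `a_n = 1` for odd `n`. -/
def offDiag (c : ℝ) (n : ℤ) : ℝ := if Even n then 2 * |c| else 1

/-- The Jacobi operator `(J y)_n = a_{n-1} y_{n-1} + a_n y_{n+1} + v_n y_n`. -/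
def jacobi (c : ℝ) (v y : ℤ → ℝ) (n : ℤ) : ℝ :=
  offDiag c (n - 1) * y (n - 1) + offDiag c n * y (n + 1) + v n * y n

/-- The `m`-periodic extension of the `j`-th standard basis vector. -/
def periodicDelta (m : ℕ) (j n : ℤ) : ℝ := if n ≡ j [ZMOD m] then 1 else 0

/-- The matrix of `J` on the space of `m`-periodic sequences (for `m` a period of the coefficients),
in the basis of the `m`-periodic delta sequences indexed by `0, …, m - 1`. -/
def periodicMatrix (c : ℝ) (v : ℤ → ℝ) (m : ℕ) : Matrix (Fin m) (Fin m) ℝ :=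
  Matrix.of fun i j => jacobi c v (periodicDelta m j) i

/-- The `m`-periodic eigenvalues of `J`, listed in nondecreasing order with multiplicity. (The
matrix is real symmetric for even `m`, so there are `m` of them.) -/
def periodicEigenvalues (c : ℝ) (v : ℤ → ℝ) (m : ℕ) : List ℝ :=
  (periodicMatrix c v m).charpoly.roots.sort (· ≤ ·)

/-- The upper end `z_n^-` (`1 ≤ n ≤ 2p`) of the `n`-th band `[z_{n-1}^+, z_n^-]`, where
`z_0^+ < z_1^- ≤ z_1^+ < z_2^- ≤ z_2^+ < … < z_{2p}^-` are the `4p` eigenvalues of the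
`4p`-periodic problem for the `2p`-periodic operator `J`. -/
def zMinus (c : ℝ) (v : ℤ → ℝ) (p n : ℕ) : ℝ := (periodicEigenvalues c v (4 * p)).getD (2 * n - 1) 0

/-- The lower end `z_n^+` (`0 ≤ n ≤ 2p - 1`) of the band `[z_n^+, z_{n+1}^-]`. -/
def zPlus (c : ℝ) (v : ℤ → ℝ) (p n : ℕ) : ℝ := (periodicEigenvalues c v (4 * p)).getD (2 * n) 0

/-- `p = p_* / 2` for even `p_*` and `p = p_*` for odd `p_*`. -/
def halfPeriod (ps : ℕ) : ℕ := if Even ps then ps / 2 else ps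

/-- `τ_n = exp (i π n / p)`. -/
def tau (p n : ℕ) : ℂ := Complex.exp (Complex.I * (Real.pi * n / p))

/-- The Fourier coefficient `(2p)⁻¹ ∑_{j=1}^p u_j τ_n^{2j}` of a real vector `(u_1, …, u_p)`. -/
def fourierCoeffP (p : ℕ) (u : ℕ → ℝ) (n : ℕ) : ℂ :=
  (1 / (2 * p : ℂ)) * ∑ j ∈ Finset.Icc 1 p, (u j : ℂ) * tau p n ^ (2 * j)

/-- The coefficient of the even-site part `v⁰ = (v_{2j})_{j=1}^p`. -/
def vHat0 (p : ℕ) (v : ℤ → ℝ) (n : ℕ) : ℂ := fourierCoeffP p (fun j => v (2 * j)) n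

/-- The coefficient of the odd-site part `v¹ = (v_{2j+1})_{j=1}^p`. -/
def vHat1 (p : ℕ) (v : ℤ → ℝ) (n : ℕ) : ℂ := fourierCoeffP p (fun j => v (2 * j + 1)) n

/-- The phase `exp (2 i arg (2|c| + τ_n))`. -/
def phase (c : ℝ) (p n : ℕ) : ℂ :=
  Complex.exp (2 * Complex.I * (Complex.arg (2 * (|c| : ℝ) + tau p n) : ℝ))

/-- The first-order coefficient `ψ_n(v)`; the value at `n = p` is used for `2|c| = 1` only. -/
def psi (c : ℝ) (p : ℕ) (v : ℤ → ℝ) (n : ℕ) : ℝ :=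
  if n = p then ‖vHat0 p v p - vHat1 p v p‖ else ‖vHat0 p v n + phase c p n * vHat1 p v n‖

/-- The number `ρ_n`; the value at `n = p` is used for `2|c| = 1` only. -/
def rho (c : ℝ) (p n : ℕ) : ℝ :=
  if n = p then 0 else ‖(-1 : ℂ) ^ n * tau p n + phase c p n‖

/-- The index set `{1, …, 2p - 1}` if `2|c| = 1`, and `{1, …, 2p - 1} \ {p}` otherwise. -/
def admissible (c : ℝ) (p : ℕ) : Set ℕ := {n | 1 ≤ n ∧ n ≤ 2 * p - 1 ∧ (n = p → 2 * |c| = 1)}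

end

/-! At `t = 0` the operator has period 2, and Bloch waves diagonalise the `4p`-periodic problem: at
frequency `s` it acts on a cell of two sites through the symbol `2|c| + exp(iπs/p)` and its
conjugate, with eigenvalues plus and minus the modulus of the symbol. This modulus decreases for `s`
in `[0, p]` and increases in `[p, 2p]`. So the waves of sign `-` with `|s| = 0, 1, 1, …, p-1, p-1,
p`, followed by those of sign `+` with `|s| = p, p+1, p+1, …, 2p-1, 2p-1, 2p`, are sorted by energy
(`blochEnergy_lt`). The edges of the `n`-th gap are entries `2n-1` and `2n`, of frequencies `-n` and
`n`. They form an isolated double eigenvalue, except that for `n = p` and `2|c| ≠ 1` they are two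
simple ones; the extreme edges are simple.

The diagonal matrix elements of `v` are its mean, hence zero (`inner_blochVector_self`), and the
element linking the two waves of a gap has modulus `ψ_n` (`norm_inner_blochVector`). A simple
eigenvalue therefore has no linear term, and a double one splits with slopes `±ψ_n`.

The remainder `O(t²)` comes from min-max (`exists_eigenvalues_add_smul_sub_le`). The trial spaces
are spanned by the unperturbed eigenvectors up to, or from, the given index; the spectral gap
absorbs the coupling to the other levels at a cost of order `t²` (`quadratic_form_arith`).

For odd `p_*`, translation by `p` exchanges even and odd sites, which ties the two Fourier
coefficients together. The zeros of `ρ_n` then follow from a factorisation into a factor in `|c|`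
and a factor in `τ_n`. -/

open scoped InnerProductSpace

/-! ### Min-max bounds for eigenvalues. -/

section MinMax

variable {E : Type*} [NormedAddCommGroup E] [InnerProductSpace ℂ E]

/-- The quadratic form of an operator which is diagonal in an orthonormal family. -/
lemma re_inner_sum_smul_of_diagonal {ι : Type*} [DecidableEq ι] {h : ι → E} (S : Finset ι)
    (T : E →ₗ[ℂ] E) (μ : ι → ℝ) (c : ι → ℂ)
    (hT : ∀ i ∈ S, ∀ j ∈ S, ⟪h i, T (h j)⟫_ℂ = if i = j then (μ i : ℂ) else 0) :
    (⟪∑ i ∈ S, c i • h i, T (∑ i ∈ S, c i • h i)⟫_ℂ).re = ∑ i ∈ S, μ i * ‖c i‖ ^ 2 := by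
  have : ⟪∑ i ∈ S, c i • h i, T (∑ i ∈ S, c i • h i)⟫_ℂ
      = ∑ i ∈ S, ((μ i * ‖c i‖ ^ 2 : ℝ) : ℂ) := by
    simp only [map_sum, map_smul, sum_inner, inner_sum, inner_smul_left, inner_smul_right]
    refine Finset.sum_congr rfl fun i hi => ?_
    rw [Finset.sum_eq_single_of_mem i hi]
    · rw [hT i hi i hi, if_pos rfl]
      push_cast
      rw [← Complex.conj_mul']
      ring
    · intro j hj hji
      rw [hT j hj i hi, if_neg hji]
      simp
  rw [this, ← Complex.ofReal_sum, Complex.ofReal_re]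

lemma norm_sq_sum_smul_of_orthonormal {ι : Type*} {h : ι → E} (hh : Orthonormal ℂ h)
    (S : Finset ι) (c : ι → ℂ) :
    ‖∑ i ∈ S, c i • h i‖ ^ 2 = ∑ i ∈ S, ‖c i‖ ^ 2 := by
  classical
  have := re_inner_sum_smul_of_diagonal (h := h) S LinearMap.id (fun _ => 1) c
    (fun i _ j _ => by simpa using (orthonormal_iff_ite.1 hh) i j)
  rw [LinearMap.id_apply] at this
  simpa [inner_self_eq_norm_sq_to_K, ← Complex.ofReal_pow] using this

lemma exists_sum_smul_of_mem_span_image {ι : Type*} {h : ι → E} {S : Finset ι} {x : E}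
    (hx : x ∈ Submodule.span ℂ (h '' S)) : ∃ c : ι → ℂ, ∑ i ∈ S, c i • h i = x := by
  classical
  obtain ⟨c, hc⟩ := (Submodule.mem_span_image_finset_iff_exists_fun ℂ).1 hx
  refine ⟨fun i => if hi : i ∈ S then c ⟨i, hi⟩ else 0, ?_⟩
  rw [← hc, ← Finset.sum_coe_sort S]
  exact Finset.sum_congr rfl fun i _ => by simp

lemma finrank_span_image_of_orthonormal {ι : Type*} {h : ι → E} (hh : Orthonormal ℂ h)
    (S : Finset ι) : Module.finrank ℂ (Submodule.span ℂ (h '' S)) = S.card := by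
  classical
  have h1 : LinearIndependent ℂ (fun i : S => h i) :=
    hh.linearIndependent.comp _ Subtype.val_injective
  have h2 := finrank_span_eq_card h1
  rw [Fintype.card_coe] at h2
  have h3 : Set.range (fun i : S => h i) = h '' S := by
    ext x
    simp
  rwa [h3] at h2

variable [FiniteDimensional ℂ E] {n : ℕ}

/-- Two subspaces whose dimensions add up to more than the dimension of the space meet. -/
lemma exists_ne_zero_mem_of_finrank_lt (W W' : Submodule ℂ E)
    (h : Module.finrank ℂ E < Module.finrank ℂ W + Module.finrank ℂ W') :
    ∃ x ∈ W, x ∈ W' ∧ x ≠ 0 := by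
  by_contra! hcon
  have : Disjoint W W' := by
    rw [Submodule.disjoint_def]
    exact hcon
  exact absurd (Submodule.finrank_add_finrank_le_of_disjoint this) (by omega)

lemma eigenvectorBasis_inner_map {T : E →ₗ[ℂ] E} (hT : T.IsSymmetric)
    (hn : Module.finrank ℂ E = n) (i j : Fin n) :
    ⟪hT.eigenvectorBasis hn i, T (hT.eigenvectorBasis hn j)⟫_ℂ
      = if i = j then (hT.eigenvalues hn i : ℂ) else 0 := by
  rw [hT.apply_eigenvectorBasis, inner_smul_right,
    orthonormal_iff_ite.1 (hT.eigenvectorBasis hn).orthonormal]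
  split_ifs with h
  · simp [h]
  · simp

/-- Upper bound for an eigenvalue (listed in nonincreasing order) by the quadratic form on a
subspace. -/
lemma eigenvalues_le_of_forall_mem {T : E →ₗ[ℂ] E} (hT : T.IsSymmetric)
    (hn : Module.finrank ℂ E = n) (i : Fin n) (W : Submodule ℂ E) (μ : ℝ)
    (hW : n ≤ Module.finrank ℂ W + i)
    (h : ∀ x ∈ W, (⟪x, T x⟫_ℂ).re ≤ μ * ‖x‖ ^ 2) : hT.eigenvalues hn i ≤ μ := by
  set e := hT.eigenvectorBasis hn
  obtain ⟨x, hx, hx', hx0⟩ := exists_ne_zero_mem_of_finrank_lt W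
    (Submodule.span ℂ (e '' (Finset.Iic i : Finset (Fin n)))) (by
      rw [finrank_span_image_of_orthonormal e.orthonormal, Fin.card_Iic, hn]; omega)
  obtain ⟨c, rfl⟩ := exists_sum_smul_of_mem_span_image hx'
  have h1 := h _ hx
  rw [re_inner_sum_smul_of_diagonal _ T _ c
    (fun i _ j _ => eigenvectorBasis_inner_map hT hn i j)] at h1
  have h2 : hT.eigenvalues hn i * ‖∑ j ∈ Finset.Iic i, c j • e j‖ ^ 2
      ≤ ∑ j ∈ Finset.Iic i, hT.eigenvalues hn j * ‖c j‖ ^ 2 := by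
    rw [norm_sq_sum_smul_of_orthonormal e.orthonormal, Finset.mul_sum]
    refine Finset.sum_le_sum fun j hj => mul_le_mul_of_nonneg_right ?_ (sq_nonneg _)
    exact hT.eigenvalues_antitone hn (Finset.mem_Iic.1 hj)
  exact le_of_mul_le_mul_right (h2.trans h1) (by positivity)

/-- Lower bound for an eigenvalue (listed in nonincreasing order) by the quadratic form on a
subspace. -/
lemma le_eigenvalues_of_forall_mem {T : E →ₗ[ℂ] E} (hT : T.IsSymmetric)
    (hn : Module.finrank ℂ E = n) (i : Fin n) (W : Submodule ℂ E) (μ : ℝ)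
    (hW : i < Module.finrank ℂ W)
    (h : ∀ x ∈ W, μ * ‖x‖ ^ 2 ≤ (⟪x, T x⟫_ℂ).re) : μ ≤ hT.eigenvalues hn i := by
  set e := hT.eigenvectorBasis hn
  obtain ⟨x, hx, hx', hx0⟩ := exists_ne_zero_mem_of_finrank_lt W
    (Submodule.span ℂ (e '' (Finset.Ici i : Finset (Fin n)))) (by
      rw [finrank_span_image_of_orthonormal e.orthonormal, Fin.card_Ici, hn]; omega)
  obtain ⟨c, rfl⟩ := exists_sum_smul_of_mem_span_image hx'
  have h1 := h _ hx
  rw [re_inner_sum_smul_of_diagonal _ T _ c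
    (fun i _ j _ => eigenvectorBasis_inner_map hT hn i j)] at h1
  have h2 : ∑ j ∈ Finset.Ici i, hT.eigenvalues hn j * ‖c j‖ ^ 2
      ≤ hT.eigenvalues hn i * ‖∑ j ∈ Finset.Ici i, c j • e j‖ ^ 2 := by
    rw [norm_sq_sum_smul_of_orthonormal e.orthonormal, Finset.mul_sum]
    refine Finset.sum_le_sum fun j hj => mul_le_mul_of_nonneg_right ?_ (sq_nonneg _)
    exact hT.eigenvalues_antitone hn (Finset.mem_Ici.1 hj)
  exact le_of_mul_le_mul_right (h1.trans h2) (by positivity)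

end MinMax

/-! ### Second-order perturbation bounds from trial spaces. -/

section Perturbation

variable {E : Type*} [NormedAddCommGroup E] [InnerProductSpace ℂ E] [FiniteDimensional ℂ E]

lemma exists_forall_norm_map_le (V : E →ₗ[ℂ] E) : ∃ C, 0 ≤ C ∧ ∀ x, ‖V x‖ ≤ C * ‖x‖ :=
  ⟨‖V.toContinuousLinearMap‖, norm_nonneg _, fun x => V.toContinuousLinearMap.le_opNorm x⟩

lemma exists_pos_forall_le_sub {ι : Type*} (S : Finset ι) (e : ι → ℝ) (z : ℝ) :
    ∃ δ, 0 < δ ∧ ∀ i ∈ S, e i < z → e i ≤ z - δ := by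
  have h : ∀ i ∈ S, ∀ᶠ δ in 𝓝[>] (0 : ℝ), e i < z → e i ≤ z - δ := by
    intro i _
    by_cases hi : e i < z
    · filter_upwards [Ioo_mem_nhdsGT (sub_pos.2 hi)] with δ hδ _
      linarith [hδ.2]
    · exact Eventually.of_forall fun δ h => absurd h hi
  obtain ⟨δ, h1, h2⟩ := (((Finset.eventually_all S).2 h).and self_mem_nhdsWithin).exists
  exact ⟨δ, h2, h1⟩

/-- Here `u` and `w` are the norms of the components below and at the eigenvalue. Half of `δ`
absorbs the terms of order `t` in `u ^ 2`; the other half completes the square with the cross term,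
leaving a multiple of `t ^ 2 * w ^ 2`. -/
lemma quadratic_form_arith {δ C μ t u w : ℝ} (hδ : 0 < δ) (ht : 0 ≤ t) 
    (htδ : t * (2 * (C + |μ|)) ≤ δ) :
    -δ * u ^ 2 + t * (C * u ^ 2 + 2 * (C * u * w) + μ * w ^ 2)
      ≤ (t * μ + 2 * C ^ 2 / δ * t ^ 2) * (u ^ 2 + w ^ 2) := by
  have h1 : -t * μ ≤ t * |μ| := by nlinarith [neg_abs_le μ]
  have h2 : (-(δ / 2) + t * C - t * μ) * u ^ 2 ≤ 0 :=
    mul_nonpos_of_nonpos_of_nonneg (by nlinarith) (sq_nonneg u)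
  have h3 : 0 ≤ 2 * C ^ 2 / δ * t ^ 2 * u ^ 2 := by positivity
  have h4 : 2 / δ * (δ / 2 * u - C * t * w) ^ 2
      = δ / 2 * u ^ 2 - 2 * (t * (C * u * w)) + 2 * C ^ 2 / δ * t ^ 2 * w ^ 2 := by
    field_simp
    ring
  have h5 : 0 ≤ 2 / δ * (δ / 2 * u - C * t * w) ^ 2 := by positivity
  nlinarith

/-- Second-order bound for the quadratic form of `A + t V` on the span of eigenvectors of `A` with
eigenvalues at most `z`, where `V` is diagonal on those with eigenvalue `z`. -/
lemma exists_quadratic_form_le {ι : Type*} [DecidableEq ι] {h : ι → E} (hh : Orthonormal ℂ h)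
    (S : Finset ι) (A V : E →ₗ[ℂ] E) (e μ : ι → ℝ) (z μ₀ : ℝ)
    (hA : ∀ i ∈ S, A (h i) = (e i : ℂ) • h i) (he : ∀ i ∈ S, e i ≤ z)
    (hV : ∀ i ∈ S, ∀ j ∈ S, e i = z → e j = z →
      ⟪h i, V (h j)⟫_ℂ = if i = j then (μ i : ℂ) else 0)
    (hμ : ∀ i ∈ S, e i = z → μ i ≤ μ₀) :
    ∃ K, ∃ t₀ > 0, ∀ t : ℝ, 0 ≤ t → t ≤ t₀ → ∀ x ∈ Submodule.span ℂ (h '' S),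
      (⟪x, (A + (t : ℂ) • V) x⟫_ℂ).re ≤ (z + t * μ₀ + K * t ^ 2) * ‖x‖ ^ 2 := by
  obtain ⟨C, hC, hVC⟩ := exists_forall_norm_map_le V
  obtain ⟨δ, hδ, heδ⟩ := exists_pos_forall_le_sub S e z
  -- The constant is the one left by completing the square; the `+ 1` only keeps the denominator
  -- positive.
  refine ⟨2 * C ^ 2 / δ, δ / (2 * (C + |μ₀|) + 1), by positivity, fun t ht htt x hx => ?_⟩
  obtain ⟨c, rfl⟩ := exists_sum_smul_of_mem_span_image hx
  have hAdiag : ∀ i ∈ S, ∀ j ∈ S, ⟪h i, A (h j)⟫_ℂ = if i = j then (e i : ℂ) else 0 := by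
    intro i _ j hj
    rw [hA j hj, inner_smul_right, orthonormal_iff_ite.1 hh]
    split_ifs with hij
    · simp [hij]
    · simp
  have hAx := re_inner_sum_smul_of_diagonal S A e c hAdiag
  have hnx := norm_sq_sum_smul_of_orthonormal hh S c
  set x := ∑ i ∈ S, c i • h i
  set u := ∑ i ∈ S with e i < z, c i • h i with hu
  set w := ∑ i ∈ S with ¬ e i < z, c i • h i with hw
  have hxuw : x = u + w := (Finset.sum_filter_add_sum_filter_not S (fun i => e i < z) _).symm
  have hnu := norm_sq_sum_smul_of_orthonormal hh (S.filter fun i => e i < z) c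
  have hnw := norm_sq_sum_smul_of_orthonormal hh (S.filter fun i => ¬ e i < z) c
  rw [← hu] at hnu
  rw [← hw] at hnw
  have hnorm : ‖x‖ ^ 2 = ‖u‖ ^ 2 + ‖w‖ ^ 2 := by
    rw [hnx, hnu, hnw, Finset.sum_filter_add_sum_filter_not]
  have hez : ∀ i ∈ S, ¬ e i < z → e i = z := fun i hi hn => le_antisymm (he i hi) (not_lt.1 hn)
  have hA1 : (⟪x, A x⟫_ℂ).re ≤ z * ‖x‖ ^ 2 - δ * ‖u‖ ^ 2 := by
    rw [hAx, hnorm, hnu, hnw, ← Finset.sum_filter_add_sum_filter_not S (fun i => e i < z),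
      mul_add, Finset.mul_sum, Finset.mul_sum, Finset.mul_sum]
    have h1 : ∑ i ∈ S with e i < z, e i * ‖c i‖ ^ 2
        ≤ ∑ i ∈ S with e i < z, (z * ‖c i‖ ^ 2 - δ * ‖c i‖ ^ 2) := by
      refine Finset.sum_le_sum fun i hi => ?_
      rw [Finset.mem_filter] at hi
      nlinarith [heδ i hi.1 hi.2, sq_nonneg ‖c i‖]
    have h2 : ∑ i ∈ S with ¬ e i < z, e i * ‖c i‖ ^ 2
        ≤ ∑ i ∈ S with ¬ e i < z, z * ‖c i‖ ^ 2 := by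
      refine Finset.sum_le_sum fun i hi => ?_
      rw [Finset.mem_filter] at hi
      exact mul_le_mul_of_nonneg_right (he i hi.1) (sq_nonneg _)
    rw [Finset.sum_sub_distrib] at h1
    linarith
  have hVw : (⟪w, V w⟫_ℂ).re ≤ μ₀ * ‖w‖ ^ 2 := by
    rw [hw, re_inner_sum_smul_of_diagonal _ V μ c, ← hw, hnw, Finset.mul_sum]
    · refine Finset.sum_le_sum fun i hi => ?_
      rw [Finset.mem_filter] at hi
      exact mul_le_mul_of_nonneg_right (hμ i hi.1 (hez i hi.1 hi.2)) (sq_nonneg _)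
    · intro i hi j hj
      rw [Finset.mem_filter] at hi hj
      exact hV i hi.1 j hj.1 (hez i hi.1 hi.2) (hez j hj.1 hj.2)
  -- Off the eigenspace of `z` nothing is known about `V` beyond boundedness; this suffices, since
  -- each such term has a factor `‖u‖`.
  have hcs : ∀ a b : E, (⟪a, V b⟫_ℂ).re ≤ C * ‖a‖ * ‖b‖ := fun a b =>
    calc (⟪a, V b⟫_ℂ).re ≤ ‖⟪a, V b⟫_ℂ‖ := Complex.re_le_norm _
      _ ≤ ‖a‖ * ‖V b‖ := norm_inner_le_norm _ _
      _ ≤ ‖a‖ * (C * ‖b‖) := mul_le_mul_of_nonneg_left (hVC b) (norm_nonneg _)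
      _ = C * ‖a‖ * ‖b‖ := by ring
  have hV1 : (⟪x, V x⟫_ℂ).re
      ≤ C * ‖u‖ ^ 2 + 2 * (C * ‖u‖ * ‖w‖) + μ₀ * ‖w‖ ^ 2 := by
    rw [hxuw, map_add, inner_add_left, inner_add_right, inner_add_right]
    simp only [Complex.add_re]
    nlinarith [hcs u u, hcs u w, hcs w u, hVw]
  have htδ : t * (2 * (C + |μ₀|)) ≤ δ := by
    rw [le_div_iff₀ (by positivity)] at htt
    linarith
  have := quadratic_form_arith (u := ‖u‖) (w := ‖w‖) hδ ht htδ
  have hsplit : (⟪x, (A + (t : ℂ) • V) x⟫_ℂ).re = (⟪x, A x⟫_ℂ).re + t * (⟪x, V x⟫_ℂ).re := by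
    simp
  rw [hsplit]
  have h3 := mul_le_mul_of_nonneg_left hV1 ht
  rw [hnorm] at hA1 ⊢
  nlinarith

/-- Second-order expansion of the eigenvalues (listed in nonincreasing order) of `A + t V`. -/
theorem exists_eigenvalues_add_smul_sub_le {n : ℕ} (hn : Module.finrank ℂ E = n)
    {h : Fin n → E} (hh : Orthonormal ℂ h) (A V : E →ₗ[ℂ] E)
    (hAV : ∀ t : ℝ, (A + (t : ℂ) • V).IsSymmetric) (e μ : Fin n → ℝ)
    (hA : ∀ i, A (h i) = (e i : ℂ) • h i) (k : Fin n)
    (hlt : ∀ i < k, e i ≤ e k) (hgt : ∀ i, k < i → e k ≤ e i)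
    (hV : ∀ i j, e i = e k → e j = e k → ⟪h i, V (h j)⟫_ℂ = if i = j then (μ i : ℂ) else 0)
    (hμlt : ∀ i < k, e i = e k → μ i ≤ μ k) (hμgt : ∀ i, k < i → e i = e k → μ k ≤ μ i) :
    ∃ K, ∃ t₀ > 0, ∀ t : ℝ, 0 ≤ t → t ≤ t₀ →
      |(hAV t).eigenvalues hn k.rev - (e k + t * μ k)| ≤ K * t ^ 2 := by
  obtain ⟨K₁, t₁, ht₁, h₁⟩ := exists_quadratic_form_le hh (Finset.Iic k) A V e μ (e k) (μ k)
    (fun i _ => hA i)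
    (fun i hi => (Finset.mem_Iic.1 hi).eq_or_lt.elim (fun h => h ▸ le_rfl) (hlt i))
    (fun i _ j _ => hV i j)
    (fun i hi he => (Finset.mem_Iic.1 hi).eq_or_lt.elim (fun h => h ▸ le_rfl)
      (fun h => hμlt i h he))
  -- The lower bound is the upper bound for `-A` and `-V` on the complementary range of indices.
  obtain ⟨K₂, t₂, ht₂, h₂⟩ := exists_quadratic_form_le hh (Finset.Ici k) (-A) (-V)
    (fun i => -e i) (fun i => -μ i) (-e k) (-μ k)
    (fun i _ => by simp [hA i])
    (fun i hi => neg_le_neg ((Finset.mem_Ici.1 hi).eq_or_lt.elim (fun h => h ▸ le_rfl) (hgt i)))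
    (fun i _ j _ hi hj => by
      rw [LinearMap.neg_apply, inner_neg_right, hV i j (neg_injective hi) (neg_injective hj)]
      split_ifs <;> simp)
    (fun i hi he => neg_le_neg ((Finset.mem_Ici.1 hi).eq_or_lt.elim (fun h => h ▸ le_rfl)
      (fun h => hμgt i h (neg_injective he))))
  refine ⟨max K₁ K₂, min t₁ t₂, lt_min ht₁ ht₂, fun t ht htt => ?_⟩
  -- The trial spaces have dimensions `k + 1` and `n - k`. The index is reversed because `h` is
  -- ordered upwards around `k`, while `eigenvalues` is nonincreasing.
  have hup := eigenvalues_le_of_forall_mem (hAV t) hn k.rev _ _ (by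
    rw [finrank_span_image_of_orthonormal hh, Fin.card_Iic, Fin.val_rev]; omega)
    (h₁ t ht (htt.trans (min_le_left _ _)))
  have hlo := le_eigenvalues_of_forall_mem (hAV t) hn k.rev
    (Submodule.span ℂ (h '' (Finset.Ici k : Finset (Fin n)))) (e k + t * μ k - K₂ * t ^ 2) (by
      rw [finrank_span_image_of_orthonormal hh, Fin.card_Ici, Fin.val_rev]; omega)
    (fun x hx => by
      have h3 := h₂ t ht (htt.trans (min_le_right _ _)) x hx
      rw [smul_neg, ← neg_add, LinearMap.neg_apply, inner_neg_right, Complex.neg_re] at h3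
      linarith)
  have h4 := mul_le_mul_of_nonneg_right (le_max_left K₁ K₂) (sq_nonneg t)
  have h5 := mul_le_mul_of_nonneg_right (le_max_right K₁ K₂) (sq_nonneg t)
  rw [abs_le]
  constructor <;> linarith

end Perturbation

/-! ### Simple and double eigenvalues with vanishing diagonal first-order term. -/

section Block

variable {E : Type*} [NormedAddCommGroup E] [InnerProductSpace ℂ E] [FiniteDimensional ℂ E]

/-- Second-order expansion at a simple eigenvalue with vanishing first-order term. -/
theorem exists_eigenvalues_sub_le_of_simple {n : ℕ} (hn : Module.finrank ℂ E = n)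
    {f : Fin n → E} (hf : Orthonormal ℂ f) (A V : E →ₗ[ℂ] E)
    (hAV : ∀ t : ℝ, (A + (t : ℂ) • V).IsSymmetric) (e : Fin n → ℝ)
    (hA : ∀ i, A (f i) = (e i : ℂ) • f i) (k : Fin n)
    (hlt : ∀ i < k, e i < e k) (hgt : ∀ i, k < i → e k < e i)
    (hV : ⟪f k, V (f k)⟫_ℂ = 0) :
    ∃ K, ∃ t₀ > 0, ∀ t : ℝ, 0 ≤ t → t ≤ t₀ →
      |(hAV t).eigenvalues hn k.rev - e k| ≤ K * t ^ 2 := by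
  have hk : ∀ i, e i = e k → i = k := by
    intro i hi
    rcases lt_trichotomy i k with h | h | h
    · exact absurd hi (hlt i h).ne
    · exact h
    · exact absurd hi (hgt i h).ne'
  have := exists_eigenvalues_add_smul_sub_le hn hf A V hAV e (fun _ => 0) hA k
    (fun i h => (hlt i h).le) (fun i h => (hgt i h).le)
    (fun i j hi hj => by simp [hk i hi, hk j hj, hV]) (fun _ _ _ => le_rfl) (fun _ _ _ => le_rfl)
  simpa using this

/-- Second-order expansion at a double eigenvalue for which the diagonal of the first-order term
vanishes. -/
theorem exists_eigenvalues_sub_le_of_double {n : ℕ} (hn : Module.finrank ℂ E = n)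
    {f : Fin n → E} (hf : Orthonormal ℂ f) (A V : E →ₗ[ℂ] E)
    (hAV : ∀ t : ℝ, (A + (t : ℂ) • V).IsSymmetric) (hVs : V.IsSymmetric) (e : Fin n → ℝ)
    (hA : ∀ i, A (f i) = (e i : ℂ) • f i) (k l : Fin n) (hkl : k < l) (hekl : e k = e l)
    (hlt : ∀ i < k, e i < e k) (hgt : ∀ i, l < i → e k < e i)
    (hmid : ∀ i, k ≤ i → i ≤ l → i = k ∨ i = l)
    (hVk : ⟪f k, V (f k)⟫_ℂ = 0) (hVl : ⟪f l, V (f l)⟫_ℂ = 0) :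
    (∃ K, ∃ t₀ > 0, ∀ t : ℝ, 0 ≤ t → t ≤ t₀ →
      |(hAV t).eigenvalues hn k.rev - (e k - t * ‖⟪f k, V (f l)⟫_ℂ‖)| ≤ K * t ^ 2) ∧
    (∃ K, ∃ t₀ > 0, ∀ t : ℝ, 0 ≤ t → t ≤ t₀ →
      |(hAV t).eigenvalues hn l.rev - (e k + t * ‖⟪f k, V (f l)⟫_ℂ‖)| ≤ K * t ^ 2) := by
  set g := ⟪f k, V (f l)⟫_ℂ with hg
  -- The block of `V` has zero diagonal and off-diagonal entries `g` and its conjugate. With `ω` the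
  -- phase of `g`, its eigenvectors are `ω • f k ∓ f l`, with eigenvalues `∓‖g‖`; `r` is the
  -- normalising factor `1 / √2`.
  obtain ⟨ω, hω, hgω⟩ : ∃ ω : ℂ, (starRingEnd ℂ) ω * ω = 1 ∧ g = ‖g‖ * ω :=
    ⟨Complex.exp (g.arg * Complex.I), by
      rw [Complex.conj_mul', Complex.norm_exp_ofReal_mul_I]; simp,
      (Complex.norm_mul_exp_arg_mul_I g).symm⟩
  have hVlk : ⟪f l, V (f k)⟫_ℂ = (starRingEnd ℂ) g := by
    rw [hg, inner_conj_symm, hVs]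
  obtain ⟨r, hr⟩ : ∃ r : ℝ, (r : ℂ) * r = 1 / 2 :=
    ⟨√(1 / 2), by rw [← Complex.ofReal_mul, Real.mul_self_sqrt (by norm_num)]; norm_num⟩
  have hne : l ≠ k := hkl.ne'
  have hff := orthonormal_iff_ite.1 hf
  have hkk : ⟪f k, f k⟫_ℂ = 1 := by simpa using hff k k
  have hll : ⟪f l, f l⟫_ℂ = 1 := by simpa using hff l l
  have hklz : ⟪f k, f l⟫_ℂ = 0 := by simpa [hne.symm] using hff k l
  have hlkz : ⟪f l, f k⟫_ℂ = 0 := by simpa [hne] using hff l k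
  set h₁ : E := (r : ℂ) • (ω • f k - f l) with hh₁
  set h₂ : E := (r : ℂ) • (ω • f k + f l) with hh₂
  -- Only the two degenerate vectors are rotated. The one with the smaller slope takes the smaller
  -- index, so that slopes increase within the block.
  set h : Fin n → E := fun i => if i = k then h₁ else if i = l then h₂ else f i with hh
  have hk : h k = h₁ := by simp [hh]
  have hl : h l = h₂ := by simp [hh, hne]
  have ho : ∀ i, i ≠ k → i ≠ l → h i = f i := fun i h1 h2 => by simp [hh, h1, h2]
  have i11 : ⟪h₁, h₁⟫_ℂ = 1 := by
    simp only [hh₁, inner_smul_left, inner_smul_right, inner_sub_left, inner_sub_right, hkk, hll,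
      hklz, hlkz, Complex.conj_ofReal]
    linear_combination 2 * hr + (r : ℂ) * r * hω
  have i22 : ⟪h₂, h₂⟫_ℂ = 1 := by
    simp only [hh₂, inner_smul_left, inner_smul_right, inner_add_left, inner_add_right, hkk, hll,
      hklz, hlkz, Complex.conj_ofReal]
    linear_combination 2 * hr + (r : ℂ) * r * hω
  have i12 : ⟪h₁, h₂⟫_ℂ = 0 := by
    simp only [hh₁, hh₂, inner_smul_left, inner_smul_right, inner_sub_left, inner_add_right, hkk,
      hll, hklz, hlkz, Complex.conj_ofReal]
    linear_combination (r : ℂ) * r * hω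
  have i21 : ⟪h₂, h₁⟫_ℂ = 0 := by rw [← inner_conj_symm, i12, map_zero]
  have i1o : ∀ i, i ≠ k → i ≠ l → ⟪h₁, f i⟫_ℂ = 0 := by
    intro i h1 h2
    simp [hh₁, hff, h1.symm, h2.symm]
  have i2o : ∀ i, i ≠ k → i ≠ l → ⟪h₂, f i⟫_ℂ = 0 := by
    intro i h1 h2
    simp [hh₂, hff, h1.symm, h2.symm]
  have hortho : Orthonormal ℂ h := by
    rw [orthonormal_iff_ite]
    intro i j
    by_cases hik : i = k
    · subst hik
      by_cases hjk : j = i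
      · subst hjk; simpa [hk] using i11
      · by_cases hjl : j = l
        · subst hjl; simpa [hk, hl, hne.symm] using i12
        · rw [hk, ho j hjk hjl, i1o j hjk hjl, if_neg (Ne.symm hjk)]
    · by_cases hil : i = l
      · subst hil
        by_cases hjk : j = k
        · subst hjk; simpa [hk, hl, hne] using i21
        · by_cases hjl : j = i
          · subst hjl; simpa [hl] using i22
          · rw [hl, ho j hjk hjl, i2o j hjk hjl, if_neg (Ne.symm hjl)]
      · rw [ho i hik hil]
        by_cases hjk : j = k
        · subst hjk
          rw [hk, ← inner_conj_symm, i1o i hik hil, map_zero, if_neg hik]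
        · by_cases hjl : j = l
          · subst hjl
            rw [hl, ← inner_conj_symm, i2o i hik hil, map_zero, if_neg hil]
          · rw [ho j hjk hjl, hff]
  have hAh : ∀ i, A (h i) = (e i : ℂ) • h i := by
    intro i
    by_cases hik : i = k
    · subst hik
      rw [hk, hh₁, map_smul, map_sub, map_smul, hA, hA, ← hekl, smul_comm _ (e i : ℂ),
        ← smul_sub, smul_comm]
    · by_cases hil : i = l
      · subst hil
        rw [hl, hh₂, map_smul, map_add, map_smul, hA, hA, hekl, smul_comm _ (e i : ℂ),
          ← smul_add, smul_comm]
      · rw [ho i hik hil, hA]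
  have hcg : (starRingEnd ℂ) g = ‖g‖ * (starRingEnd ℂ) ω := by
    conv_lhs => rw [hgω]
    simp
  have v11 : ⟪h₁, V h₁⟫_ℂ = ((-‖g‖ : ℝ) : ℂ) := by
    simp only [hh₁, map_smul, map_sub, inner_smul_left, inner_smul_right, inner_sub_left,
      inner_sub_right, hVk, hVl, hVlk, ← hg, Complex.conj_ofReal, Complex.ofReal_neg]
    linear_combination -((r : ℂ) * r * ((starRingEnd ℂ) ω * hgω + ω * hcg))
      - 2 * (r : ℂ) * r * ‖g‖ * hω - 2 * ‖g‖ * hr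
  have v22 : ⟪h₂, V h₂⟫_ℂ = ((‖g‖ : ℝ) : ℂ) := by
    simp only [hh₂, map_smul, map_add, inner_smul_left, inner_smul_right, inner_add_left,
      inner_add_right, hVk, hVl, hVlk, ← hg, Complex.conj_ofReal]
    linear_combination (r : ℂ) * r * ((starRingEnd ℂ) ω * hgω + ω * hcg)
      + 2 * (r : ℂ) * r * ‖g‖ * hω + 2 * ‖g‖ * hr
  have v12 : ⟪h₁, V h₂⟫_ℂ = 0 := by
    simp only [hh₁, hh₂, map_smul, map_add, inner_smul_left, inner_smul_right, inner_sub_left,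
      inner_add_right, hVk, hVl, hVlk, ← hg, Complex.conj_ofReal]
    linear_combination (r : ℂ) * r * ((starRingEnd ℂ) ω * hgω - ω * hcg)
  have v21 : ⟪h₂, V h₁⟫_ℂ = 0 := by rw [← hVs, ← inner_conj_symm, v12, map_zero]
  have hblock : ∀ i, e i = e k → i = k ∨ i = l := by
    intro i hi
    refine hmid i (not_lt.1 fun h => (hlt i h).ne hi) (not_lt.1 fun h => (hgt i h).ne' hi)
  set μ : Fin n → ℝ := fun i => if i = k then -‖g‖ else ‖g‖ with hμ
  have hμk : μ k = -‖g‖ := by simp [hμ]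
  have hμl : μ l = ‖g‖ := by simp [hμ, hne]
  have hμle : -‖g‖ ≤ ‖g‖ := by linarith [norm_nonneg g]
  have hVh : ∀ i j, e i = e k → e j = e k →
      ⟪h i, V (h j)⟫_ℂ = if i = j then (μ i : ℂ) else 0 := by
    intro i j hi hj
    rcases hblock i hi with rfl | rfl <;> rcases hblock j hj with rfl | rfl
    · rw [if_pos rfl, hk, v11, hμk]
    · rw [if_neg hne.symm, hk, hl, v12]
    · rw [if_neg hne, hk, hl, v21]
    · rw [if_pos rfl, hl, v22, hμl]
  constructor
  · have := exists_eigenvalues_add_smul_sub_le hn hortho A V hAV e μ hAh k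
      (fun i hi => (hlt i hi).le) (fun i hi => by
        rcases le_or_gt i l with h' | h'
        · rcases hmid i hi.le h' with rfl | rfl
          · exact le_rfl
          · exact hekl.le
        · exact (hgt i h').le) hVh
      (fun i hi he => absurd he (hlt i hi).ne) (fun i hi he => by
        rcases hblock i he with rfl | rfl
        · exact le_rfl
        · rw [hμk, hμl]; exact hμle)
    simpa [hμk, ← sub_eq_add_neg] using this
  · rw [hekl] at hlt hgt hVh hblock ⊢
    have := exists_eigenvalues_add_smul_sub_le hn hortho A V hAV e μ hAh l
      (fun i hi => by
        rcases lt_or_ge i k with h' | h'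
        · exact (hlt i h').le
        · rcases hmid i h' hi.le with rfl | rfl
          · exact hekl.le
          · exact le_rfl) (fun i hi => (hgt i hi).le) hVh
      (fun i hi he => by
        rcases hblock i he with rfl | rfl
        · rw [hμk, hμl]; exact hμle
        · exact le_rfl) (fun i hi he => absurd he (hgt i hi).ne')
    simpa [hμl] using this

end Block

/-! ### From operators on `ℂ ^ m` to sorted roots of characteristic polynomials. -/

section MatrixEigenvalues

open Matrix

variable {m : ℕ}

/-- The operator on `ℂ ^ m` given by a real matrix. -/
noncomputable def complexOperator (M : Matrix (Fin m) (Fin m) ℝ) :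
    EuclideanSpace ℂ (Fin m) →ₗ[ℂ] EuclideanSpace ℂ (Fin m) :=
  toEuclideanLin (M.map (algebraMap ℝ ℂ))

lemma complexOperator_isSymmetric {M : Matrix (Fin m) (Fin m) ℝ} (hM : M.IsHermitian) :
    (complexOperator M).IsSymmetric := by
  rw [complexOperator, isSymmetric_toEuclideanLin_iff]
  exact hM.map _ fun x => by simp

lemma complexOperator_add_smul (M D : Matrix (Fin m) (Fin m) ℝ) (t : ℝ) :
    complexOperator (M + t • D) = complexOperator M + (t : ℂ) • complexOperator D := by
  have h : (M + t • D).map (algebraMap ℝ ℂ)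
      = M.map (algebraMap ℝ ℂ) + (t : ℂ) • D.map (algebraMap ℝ ℂ) := by
    ext i j
    simp
  rw [complexOperator, complexOperator, complexOperator, h, map_add, map_smul]

/-- The sorted list of roots of the characteristic polynomial consists of the eigenvalues. -/
lemma sort_roots_charpoly_getD {M : Matrix (Fin m) (Fin m) ℝ} (hM : M.IsHermitian)
    {T : EuclideanSpace ℂ (Fin m) →ₗ[ℂ] EuclideanSpace ℂ (Fin m)} (hT : T.IsSymmetric)
    (hTM : T = complexOperator M) (k : Fin m) :
    (M.charpoly.roots.sort (· ≤ ·)).getD k 0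
      = hT.eigenvalues finrank_euclideanSpace_fin k.rev := by
  have h1 := hT.roots_charpoly_eq_eigenvalues finrank_euclideanSpace_fin
  have h2 : T.charpoly = M.charpoly.map (algebraMap ℝ ℂ) := by
    rw [← Matrix.charpoly_map, hTM, complexOperator, toEuclideanLin_eq_toLin_orthonormal,
      charpoly_toLin]
  -- The real characteristic polynomial splits, so its complex roots are the images of its real
  -- ones, and the embedding of `ℝ` can be cancelled.
  rw [h2, hM.splits_charpoly.roots_map, ← Multiset.map_map] at h1
  have h3 := Multiset.map_injective (algebraMap ℝ ℂ).injective h1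
  have h4 : M.charpoly.roots
      = (List.ofFn fun i : Fin m => hT.eigenvalues finrank_euclideanSpace_fin i.rev : List ℝ) := by
    rw [h3, ← Fin.univ_val_map]
    conv_lhs => rw [← Multiset.map_univ_val_equiv Fin.revPerm, Multiset.map_map]
    rfl
  have h5 : M.charpoly.roots.sort (· ≤ ·)
      = List.ofFn fun i : Fin m => hT.eigenvalues finrank_euclideanSpace_fin i.rev := by
    rw [h4, Multiset.coe_sort]
    apply List.mergeSort_of_pairwise
    simp_rw [decide_eq_true_eq, ← List.sortedLE_iff_pairwise]
    refine Monotone.sortedLE_ofFn fun i j hij => ?_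
    exact hT.eigenvalues_antitone _ (Fin.rev_le_rev.2 hij)
  rw [h5, List.getD_eq_getElem _ _ (by simp), List.getElem_ofFn]

variable {f : Fin m → EuclideanSpace ℂ (Fin m)} {M D : Matrix (Fin m) (Fin m) ℝ}

theorem exists_sort_roots_sub_le_of_simple (hM : M.IsHermitian) (hD : D.IsHermitian)
    (hf : Orthonormal ℂ f) (e : Fin m → ℝ) (hA : ∀ i, complexOperator M (f i) = (e i : ℂ) • f i)
    (k : Fin m) (hlt : ∀ i < k, e i < e k) (hgt : ∀ i, k < i → e k < e i)
    (hV : ⟪f k, complexOperator D (f k)⟫_ℂ = 0) :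
    ∃ K, ∃ t₀ > 0, ∀ t : ℝ, 0 ≤ t → t ≤ t₀ →
      |((M + t • D).charpoly.roots.sort (· ≤ ·)).getD k 0 - e k| ≤ K * t ^ 2 := by
  have hS : ∀ t : ℝ, (M + t • D).IsHermitian := fun t => hM.add (hD.smul (IsSelfAdjoint.all t))
  have hAV : ∀ t : ℝ, (complexOperator M + (t : ℂ) • complexOperator D).IsSymmetric := fun t => by
    rw [← complexOperator_add_smul]
    exact complexOperator_isSymmetric (hS t)
  have := exists_eigenvalues_sub_le_of_simple finrank_euclideanSpace_fin hf _ _ hAV e hA k hlt hgt hV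
  simpa only [← sort_roots_charpoly_getD (hS _) (hAV _) (complexOperator_add_smul M D _).symm]
    using this

theorem exists_sort_roots_sub_le_of_double (hM : M.IsHermitian) (hD : D.IsHermitian)
    (hf : Orthonormal ℂ f) (e : Fin m → ℝ) (hA : ∀ i, complexOperator M (f i) = (e i : ℂ) • f i)
    (k l : Fin m) (hkl : k < l) (hekl : e k = e l)
    (hlt : ∀ i < k, e i < e k) (hgt : ∀ i, l < i → e k < e i)
    (hmid : ∀ i, k ≤ i → i ≤ l → i = k ∨ i = l)
    (hVk : ⟪f k, complexOperator D (f k)⟫_ℂ = 0) (hVl : ⟪f l, complexOperator D (f l)⟫_ℂ = 0) :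
    (∃ K, ∃ t₀ > 0, ∀ t : ℝ, 0 ≤ t → t ≤ t₀ →
      |((M + t • D).charpoly.roots.sort (· ≤ ·)).getD k 0
        - (e k - t * ‖⟪f k, complexOperator D (f l)⟫_ℂ‖)| ≤ K * t ^ 2) ∧
    (∃ K, ∃ t₀ > 0, ∀ t : ℝ, 0 ≤ t → t ≤ t₀ →
      |((M + t • D).charpoly.roots.sort (· ≤ ·)).getD l 0
        - (e k + t * ‖⟪f k, complexOperator D (f l)⟫_ℂ‖)| ≤ K * t ^ 2) := by
  have hS : ∀ t : ℝ, (M + t • D).IsHermitian := fun t => hM.add (hD.smul (IsSelfAdjoint.all t))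
  have hAV : ∀ t : ℝ, (complexOperator M + (t : ℂ) • complexOperator D).IsSymmetric := fun t => by
    rw [← complexOperator_add_smul]
    exact complexOperator_isSymmetric (hS t)
  have := exists_eigenvalues_sub_le_of_double finrank_euclideanSpace_fin hf _ _ hAV
    (complexOperator_isSymmetric hD) e hA k l hkl hekl hlt hgt hmid hVk hVl
  simpa only [← sort_roots_charpoly_getD (hS _) (hAV _) (complexOperator_add_smul M D _).symm]
    using this

end MatrixEigenvalues

/-! ### Roots of unity with integer frequencies, and their orthogonality. -/

section RootsOfUnity

/-- The root of unity `exp (i π s / p)` for an integer `s`. -/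
noncomputable def unitRoot (p : ℕ) (s : ℤ) : ℂ := Complex.exp (Complex.I * (Real.pi * s / p))

lemma unitRoot_natCast (p n : ℕ) : unitRoot p n = tau p n := by
  simp [unitRoot, tau]

lemma unitRoot_add (p : ℕ) (s t : ℤ) : unitRoot p (s + t) = unitRoot p s * unitRoot p t := by
  rw [unitRoot, unitRoot, unitRoot, ← Complex.exp_add]
  congr 1
  push_cast
  ring

@[simp] lemma unitRoot_zero (p : ℕ) : unitRoot p 0 = 1 := by simp [unitRoot]

lemma unitRoot_eq_exp_ofReal (p : ℕ) (s : ℤ) :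
    unitRoot p s = Complex.exp ((Real.pi * s / p : ℝ) * Complex.I) := by
  rw [unitRoot, mul_comm]
  push_cast
  rfl

lemma conj_unitRoot (p : ℕ) (s : ℤ) : (starRingEnd ℂ) (unitRoot p s) = unitRoot p (-s) := by
  rw [unitRoot_eq_exp_ofReal, unitRoot_eq_exp_ofReal, ← Complex.exp_conj]
  congr 1
  simp
  ring

lemma unitRoot_mul_natCast (p : ℕ) (s : ℤ) (j : ℕ) : unitRoot p (s * j) = unitRoot p s ^ j := by
  rw [unitRoot, unitRoot, ← Complex.exp_nat_mul]
  congr 1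
  push_cast
  ring

lemma unitRoot_eq_one_iff {p : ℕ} (hp : 0 < p) (s : ℤ) :
    unitRoot p s = 1 ↔ (2 * p : ℤ) ∣ s := by
  have hp' : (p : ℂ) ≠ 0 := by exact_mod_cast hp.ne'
  rw [unitRoot, Complex.exp_eq_one_iff, dvd_def]
  refine exists_congr fun q => ?_
  have hpi : (Real.pi : ℂ) ≠ 0 := by exact_mod_cast Real.pi_ne_zero
  have h : Complex.I * (Real.pi * s / p) = q * (2 * Real.pi * Complex.I)
      ↔ (s : ℂ) = 2 * p * q := by
    rw [show Complex.I * (Real.pi * s / p) = Real.pi * Complex.I * (s / p) by ring,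
      show (q : ℂ) * (2 * Real.pi * Complex.I) = Real.pi * Complex.I * (2 * q) by ring,
      mul_right_inj' (mul_ne_zero hpi Complex.I_ne_zero), div_eq_iff hp']
    ring_nf
  rw [h]
  exact_mod_cast Iff.rfl

lemma unitRoot_two_mul_mul {p : ℕ} (hp : 0 < p) (q : ℤ) : unitRoot p (2 * p * q) = 1 :=
  (unitRoot_eq_one_iff hp _).2 ⟨q, rfl⟩

lemma unitRoot_self {p : ℕ} (hp : 0 < p) : unitRoot p p = -1 := by
  have hp' : (p : ℂ) ≠ 0 := by exact_mod_cast hp.ne'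
  rw [unitRoot, Int.cast_natCast, mul_div_cancel_right₀ _ hp', mul_comm, Complex.exp_pi_mul_I]

lemma unitRoot_congr {p : ℕ} (hp : 0 < p) {s t : ℤ} (q : ℤ) (h : s = t + 2 * p * q) :
    unitRoot p s = unitRoot p t := by
  rw [h, unitRoot_add, unitRoot_two_mul_mul hp, mul_one]

lemma sum_unitRoot_mul {p : ℕ} (hp : 0 < p) (s : ℤ) :
    ∑ j ∈ Finset.range (2 * p), unitRoot p (s * j)
      = if (2 * p : ℤ) ∣ s then 2 * (p : ℂ) else 0 := by
  simp_rw [unitRoot_mul_natCast]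
  split_ifs with h
  · rw [(unitRoot_eq_one_iff hp s).2 h]
    simp
  · have h1 : unitRoot p s - 1 ≠ 0 := sub_ne_zero.2 fun h1 => h ((unitRoot_eq_one_iff hp s).1 h1)
    have h2 := geom_sum_mul (unitRoot p s) (2 * p)
    rw [← unitRoot_mul_natCast, show s * ((2 * p : ℕ) : ℤ) = 2 * p * s by push_cast; ring,
      unitRoot_two_mul_mul hp, sub_self] at h2
    exact (mul_eq_zero.1 h2).resolve_right h1

end RootsOfUnity

/-! ### The symbol, its phase, and the monotonicity of its modulus. -/

section Symbol

/-- The symbol `2 |c| + exp (i π s / p)`. -/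
noncomputable def symbol (c : ℝ) (p : ℕ) (s : ℤ) : ℂ := 2 * ((|c| : ℝ) : ℂ) + unitRoot p s

/-- The normalised symbol, which is `1` where the symbol vanishes. -/
noncomputable def symbolPhase (c : ℝ) (p : ℕ) (s : ℤ) : ℂ :=
  if symbol c p s = 0 then 1 else symbol c p s / ‖symbol c p s‖

lemma conj_symbol (c : ℝ) (p : ℕ) (s : ℤ) :
    (starRingEnd ℂ) (symbol c p s) = symbol c p (-s) := by
  simp only [symbol, map_add, map_mul, Complex.conj_ofReal, conj_unitRoot, Complex.conj_ofNat]

lemma norm_symbol_neg (c : ℝ) (p : ℕ) (s : ℤ) : ‖symbol c p (-s)‖ = ‖symbol c p s‖ := by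
  rw [← conj_symbol, Complex.norm_conj]

lemma conj_symbolPhase (c : ℝ) (p : ℕ) (s : ℤ) :
    (starRingEnd ℂ) (symbolPhase c p s) = symbolPhase c p (-s) := by
  simp only [symbolPhase, ← conj_symbol, map_eq_zero]
  split_ifs <;> simp

lemma norm_mul_symbolPhase (c : ℝ) (p : ℕ) (s : ℤ) :
    ‖symbol c p s‖ * symbolPhase c p s = symbol c p s := by
  rw [symbolPhase]
  split_ifs with h
  · simp [h]
  · have : (‖symbol c p s‖ : ℂ) ≠ 0 := by simpa using h
    field_simp

lemma conj_symbolPhase_mul_self (c : ℝ) (p : ℕ) (s : ℤ) :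
    (starRingEnd ℂ) (symbolPhase c p s) * symbolPhase c p s = 1 := by
  rw [Complex.conj_mul', symbolPhase]
  split_ifs with h
  · simp
  · simp [h]

lemma symbolPhase_mul_conj_symbol (c : ℝ) (p : ℕ) (s : ℤ) :
    symbolPhase c p s * (starRingEnd ℂ) (symbol c p s) = ‖symbol c p s‖ := by
  conv_lhs => rw [← norm_mul_symbolPhase]
  rw [map_mul, Complex.conj_ofReal]
  linear_combination (‖symbol c p s‖ : ℂ) * conj_symbolPhase_mul_self c p s

lemma norm_symbol_sq (c : ℝ) (p : ℕ) (s : ℤ) :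
    ‖symbol c p s‖ ^ 2 = (2 * |c|) ^ 2 + 1 + 2 * (2 * |c|) * Real.cos (Real.pi * s / p) := by
  rw [← Complex.normSq_eq_norm_sq, Complex.normSq_apply, symbol, unitRoot_eq_exp_ofReal]
  simp only [Complex.add_re, Complex.add_im, Complex.exp_ofReal_mul_I_re,
    Complex.exp_ofReal_mul_I_im, Complex.mul_re, Complex.mul_im, Complex.ofReal_re,
    Complex.ofReal_im, Complex.re_ofNat, Complex.im_ofNat]
  linear_combination Real.sin_sq_add_cos_sq (Real.pi * s / p)

/-- By the law of cosines the squared modulus is increasing in `cos (π s / p)`, and cosine decreases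
on `[0, π]`. -/
lemma norm_symbol_strictAnti {c : ℝ} (hc : c ≠ 0) {p : ℕ} (hp : 0 < p) {s t : ℤ} (hs : 0 ≤ s)
    (hst : s < t) (ht : t ≤ p) : ‖symbol c p t‖ < ‖symbol c p s‖ := by
  refine lt_of_pow_lt_pow_left₀ 2 (norm_nonneg _) ?_
  rw [norm_symbol_sq, norm_symbol_sq]
  have hp' : (0 : ℝ) < p := by exact_mod_cast hp
  have hc' : 0 < |c| := abs_pos.2 hc
  have hs' : (0 : ℝ) ≤ s := by exact_mod_cast hs
  have hst' : (s : ℝ) < t := by exact_mod_cast hst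
  have ht' : (t : ℝ) ≤ p := by exact_mod_cast ht
  have h : Real.cos (Real.pi * t / p) < Real.cos (Real.pi * s / p) := by
    apply Real.cos_lt_cos_of_nonneg_of_le_pi
    · positivity
    · rw [div_le_iff₀ hp']
      exact mul_le_mul_of_nonneg_left ht' Real.pi_pos.le
    · have := Real.pi_pos
      gcongr
  nlinarith

lemma norm_symbol_reflect (c : ℝ) {p : ℕ} (hp : 0 < p) (s : ℤ) :
    ‖symbol c p (2 * p - s)‖ = ‖symbol c p s‖ := by
  rw [← norm_symbol_neg c p s, symbol, symbol, unitRoot_congr hp (t := -s) 1 (by ring)]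

lemma norm_symbol_strictMono {c : ℝ} (hc : c ≠ 0) {p : ℕ} (hp : 0 < p) {s t : ℤ} (hs : p ≤ s)
    (hst : s < t) (ht : t ≤ 2 * p) : ‖symbol c p s‖ < ‖symbol c p t‖ := by
  rw [← norm_symbol_reflect c hp s, ← norm_symbol_reflect c hp t]
  exact norm_symbol_strictAnti hc hp (by omega) (by omega) (by omega)

lemma norm_symbol_self (c : ℝ) {p : ℕ} (hp : 0 < p) : ‖symbol c p p‖ = |2 * |c| - 1| := by
  have : symbol c p p = ((2 * |c| - 1 : ℝ) : ℂ) := by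
    rw [symbol, unitRoot_self hp]
    push_cast
    ring
  rw [this, Complex.norm_real, Real.norm_eq_abs]

lemma norm_symbol_pos {c : ℝ} (hc : c ≠ 0) {p : ℕ} (hp : 0 < p) {s : ℤ} (hs : 0 ≤ s)
    (hs' : s ≤ 2 * p) (hsp : s ≠ p) : 0 < ‖symbol c p s‖ := by
  rcases lt_or_gt_of_ne hsp with h | h
  · exact (norm_nonneg _).trans_lt (norm_symbol_strictAnti hc hp hs h le_rfl)
  · exact (norm_nonneg _).trans_lt (norm_symbol_strictMono hc hp le_rfl h hs')

lemma phase_eq_symbolPhase_sq {c : ℝ} {p n : ℕ} (h : symbol c p n ≠ 0) :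
    phase c p n = symbolPhase c p n ^ 2 := by
  have h0 : (‖symbol c p n‖ : ℂ) ≠ 0 := by simpa using h
  have h1 : symbolPhase c p n = Complex.exp ((symbol c p n).arg * Complex.I) := by
    rw [symbolPhase, if_neg h, div_eq_iff h0, mul_comm, Complex.norm_mul_exp_arg_mul_I]
  rw [h1, phase, ← Complex.exp_nat_mul, ← unitRoot_natCast, symbol]
  congr 1
  push_cast
  ring

end Symbol

/-! ### The matrix of the operator on periodic sequences. -/

section PeriodicMatrix

open Matrix

lemma offDiag_two_mul (c : ℝ) (j : ℤ) : offDiag c (2 * j) = 2 * |c| := by simp [offDiag]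

lemma offDiag_two_mul_add_one (c : ℝ) (j : ℤ) : offDiag c (2 * j + 1) = 1 := by
  simp [offDiag]

lemma offDiag_congr (c : ℝ) {p : ℕ} {i j : ℤ} (h : i ≡ j [ZMOD (4 * p : ℕ)]) :
    offDiag c i = offDiag c j := by
  obtain ⟨q, hq⟩ := h.dvd
  have : Even i ↔ Even j := by
    rw [show j = i + 2 * (2 * p * q) by push_cast at hq; linarith]
    simp [Int.even_add]
  simp [offDiag, this]

lemma periodicDelta_fin (m : ℕ) (i j : Fin m) :
    periodicDelta m j i = if i = j then 1 else 0 := by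
  rw [periodicDelta]
  congr 1
  rw [Int.natCast_modEq_iff, Nat.ModEq, Nat.mod_eq_of_lt i.2, Nat.mod_eq_of_lt j.2, Fin.ext_iff]

lemma periodicMatrix_smul (c : ℝ) (v : ℤ → ℝ) (m : ℕ) (t : ℝ) :
    periodicMatrix c (fun n => t * v n) m
      = periodicMatrix c 0 m + t • diagonal fun i : Fin m => v i := by
  ext i j
  simp only [periodicMatrix, jacobi, of_apply, Matrix.add_apply, Matrix.smul_apply, diagonal_apply,
    periodicDelta_fin, Pi.zero_apply, smul_eq_mul]
  split_ifs <;> ring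

/-- The bond to the left of a site is the bond to the right of its neighbour. This survives the
wrap-around because `4 * p` is even, so `offDiag` is well defined modulo `4 * p`. -/
lemma periodicMatrix_isHermitian (c : ℝ) (p : ℕ) :
    (periodicMatrix c 0 (4 * p)).IsHermitian := by
  have key : ∀ i j : ℤ, offDiag c (i - 1) * periodicDelta (4 * p) j (i - 1)
      = offDiag c j * periodicDelta (4 * p) i (j + 1) := by
    intro i j
    have hiff : i - 1 ≡ j [ZMOD (4 * p : ℕ)] ↔ j + 1 ≡ i [ZMOD (4 * p : ℕ)] := by
      constructor <;> intro h
      · simpa using (h.add_right 1).symm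
      · simpa using (h.sub_right 1).symm
    by_cases h : i - 1 ≡ j [ZMOD (4 * p : ℕ)]
    · rw [periodicDelta, periodicDelta, if_pos h, if_pos (hiff.1 h), offDiag_congr c h]
    · rw [periodicDelta, periodicDelta, if_neg h, if_neg (mt hiff.2 h), mul_zero, mul_zero]
  refine Matrix.IsHermitian.ext fun i j => ?_
  simp only [periodicMatrix, jacobi, of_apply, Pi.zero_apply, zero_mul, add_zero, star_trivial]
  rw [key, ← key i j, add_comm]

lemma sum_periodicDelta_mul {m : ℕ} (hm : 0 < m) {y : ℤ → ℂ} (hy : ∀ n, y (n + m) = y n) (n : ℤ) :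
    ∑ j : Fin m, (periodicDelta m j n : ℂ) * y j = y n := by
  have hm' : (0 : ℤ) < m := by exact_mod_cast hm
  have h0 := Int.emod_nonneg n hm'.ne'
  have h1 := Int.emod_lt_of_pos n hm'
  rw [Finset.sum_eq_single ⟨(n % m).toNat, by omega⟩]
  · have h2 : ((n % m).toNat : ℤ) = n % m := Int.toNat_of_nonneg h0
    have h3 : n ≡ n % m [ZMOD m] := (Int.mod_modEq n m).symm
    simp only [periodicDelta, h2, if_pos h3, Complex.ofReal_one, one_mul]
    have hper : Function.Periodic y (m : ℤ) := hy
    rw [Int.emod_def, mul_comm, ← smul_eq_mul]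
    exact hper.sub_zsmul_eq _
  · intro j _ hj
    have : ¬ n ≡ j [ZMOD m] := by
      intro h
      apply hj
      ext
      have : n % m = j := by rw [h, Int.emod_eq_of_lt (by omega) (by exact_mod_cast j.2)]
      simp [this]
    simp [periodicDelta, this]
  · simp

lemma complexOperator_periodicMatrix (c : ℝ) {m : ℕ} (hm : 0 < m) {y : ℤ → ℂ}
    (hy : ∀ n, y (n + m) = y n) :
    complexOperator (periodicMatrix c 0 m) (WithLp.toLp 2 fun i : Fin m => y i)
      = WithLp.toLp 2 fun i : Fin m =>
        (offDiag c (i - 1) : ℂ) * y (i - 1) + (offDiag c i : ℂ) * y (i + 1) := by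
  rw [complexOperator, toLpLin_apply]
  congr 1
  ext i
  simp only [mulVec, dotProduct, Matrix.map_apply, periodicMatrix, of_apply, jacobi, Pi.zero_apply,
    zero_mul, add_zero, Complex.coe_algebraMap, Complex.ofReal_add, Complex.ofReal_mul, add_mul,
    mul_assoc, Finset.sum_add_distrib, ← Finset.mul_sum]
  rw [sum_periodicDelta_mul hm hy, sum_periodicDelta_mul hm hy]

lemma inner_complexOperator_diagonal {m : ℕ} (d : ℤ → ℝ) (x y : ℤ → ℂ) :
    ⟪WithLp.toLp 2 fun i : Fin m => x i,
      complexOperator (diagonal fun i : Fin m => d i) (WithLp.toLp 2 fun i : Fin m => y i)⟫_ℂ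
      = ∑ i ∈ Finset.range m, (d i : ℂ) * ((starRingEnd ℂ) (x i) * y i) := by
  rw [complexOperator, toLpLin_apply, PiLp.inner_apply, Finset.sum_range]
  refine Finset.sum_congr rfl fun i _ => ?_
  rw [diagonal_map (map_zero _)]
  simp [mulVec_diagonal]
  ring

lemma sum_range_two_mul {R : Type*} [AddCommMonoid R] (F : ℕ → R) (m : ℕ) :
    ∑ i ∈ Finset.range (2 * m), F i = ∑ j ∈ Finset.range m, (F (2 * j) + F (2 * j + 1)) := by
  induction m with
  | zero => simp
  | succ m ih =>
    rw [Finset.sum_range_succ, ← ih, mul_add, mul_one, Finset.sum_range_succ,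
      Finset.sum_range_succ, add_assoc]

end PeriodicMatrix

/-! ### Bloch waves: eigenfunctions, orthonormality and ordering of energies. -/

section BlochWaves

open Matrix

/-- The Bloch wave of frequency `s` and sign `ε`. -/
noncomputable def blochWave (c : ℝ) (p : ℕ) (s : ℤ) (ε : ℝ) (n : ℤ) : ℂ :=
  (if Even n then 1 else ε * symbolPhase c p s) * unitRoot p (s * (n / 2))

lemma blochWave_two_mul (c : ℝ) (p : ℕ) (s : ℤ) (ε : ℝ) (j : ℤ) :
    blochWave c p s ε (2 * j) = unitRoot p (s * j) := by
  simp [blochWave]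

lemma blochWave_two_mul_add_one (c : ℝ) (p : ℕ) (s : ℤ) (ε : ℝ) (j : ℤ) :
    blochWave c p s ε (2 * j + 1) = ε * symbolPhase c p s * unitRoot p (s * j) := by
  have : (2 * j + 1) / 2 = j := by omega
  simp [blochWave, this]

lemma blochWave_periodic (c : ℝ) {p : ℕ} (hp : 0 < p) (s : ℤ) (ε : ℝ) (n : ℤ) :
    blochWave c p s ε (n + (4 * p : ℕ)) = blochWave c p s ε n := by
  have h1 : (n + (4 * p : ℕ)) / 2 = n / 2 + 2 * p := by push_cast; omega
  have h2 : Even (n + (4 * p : ℕ)) ↔ Even n := by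
    rw [Int.even_add]
    simp [show Even (4 : ℤ) by decide]
  simp only [blochWave, h1, h2]
  rw [unitRoot_congr hp (t := s * (n / 2)) s (by ring)]

/-- Bloch waves are eigenfunctions of the unperturbed operator. -/
lemma jacobi_blochWave (c : ℝ) (p : ℕ) (s : ℤ) {ε : ℝ} (hε : ε * ε = 1) (n : ℤ) :
    (offDiag c (n - 1) : ℂ) * blochWave c p s ε (n - 1) + offDiag c n * blochWave c p s ε (n + 1)
      = ((ε * ‖symbol c p s‖ : ℝ) : ℂ) * blochWave c p s ε n := by
  have hε' : (ε : ℂ) * ε = 1 := by exact_mod_cast hε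
  -- The two neighbours of an even site combine to the conjugate symbol, those of an odd site to the
  -- symbol; the phase on odd sites turns both into the modulus.
  obtain ⟨j, rfl | rfl⟩ := Int.even_or_odd' n
  · have h1 : (2 * j - 1 : ℤ) = 2 * (j - 1) + 1 := by ring
    rw [h1, offDiag_two_mul_add_one, offDiag_two_mul, blochWave_two_mul, blochWave_two_mul_add_one,
      blochWave_two_mul_add_one, mul_sub, mul_one, sub_eq_add_neg, unitRoot_add]
    have h2 := symbolPhase_mul_conj_symbol c p s
    rw [conj_symbol, symbol] at h2
    push_cast
    linear_combination (ε : ℂ) * unitRoot p (s * j) * h2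
  · have h1 : (2 * j + 1 - 1 : ℤ) = 2 * j := by ring
    have h3 : (2 * j + 1 + 1 : ℤ) = 2 * (j + 1) := by ring
    rw [h1, h3, offDiag_two_mul_add_one, offDiag_two_mul, blochWave_two_mul, blochWave_two_mul,
      blochWave_two_mul_add_one, mul_add, mul_one, unitRoot_add]
    have h2 := norm_mul_symbolPhase c p s
    rw [symbol] at h2 ⊢
    push_cast
    linear_combination -unitRoot p (s * j) * h2
      - (‖2 * ((|c| : ℝ) : ℂ) + unitRoot p s‖ : ℂ) * symbolPhase c p s * unitRoot p (s * j) * hε'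

lemma sum_mul_conj_blochWave_mul (c : ℝ) (p : ℕ) (s t : ℤ) (ε η : ℝ) (d : ℤ → ℝ) :
    ∑ i ∈ Finset.range (4 * p),
      (d i : ℂ) * ((starRingEnd ℂ) (blochWave c p s ε i) * blochWave c p t η i)
    = ∑ j ∈ Finset.range (2 * p), (d (2 * j) + ε * η *
        ((starRingEnd ℂ) (symbolPhase c p s) * symbolPhase c p t) * d (2 * j + 1))
          * unitRoot p ((t - s) * j) := by
  rw [show 4 * p = 2 * (2 * p) by ring, sum_range_two_mul]
  refine Finset.sum_congr rfl fun j _ => ?_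
  push_cast
  rw [blochWave_two_mul, blochWave_two_mul, blochWave_two_mul_add_one, blochWave_two_mul_add_one,
    map_mul, map_mul, conj_unitRoot, sub_mul, sub_eq_add_neg, unitRoot_add, Complex.conj_ofReal]
  ring

/-- The frequency of the `k`-th Bloch wave. -/
def waveNumber (k : ℕ) : ℤ := if Even k then ((k / 2 : ℕ) : ℤ) else -(((k + 1) / 2 : ℕ) : ℤ)

/-- The sign of the `k`-th Bloch wave. -/
noncomputable def waveSign (p k : ℕ) : ℝ := if k < 2 * p then -1 else 1

lemma waveSign_mul_self (p k : ℕ) : waveSign p k * waveSign p k = 1 := by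
  rw [waveSign]
  split_ifs <;> norm_num

lemma waveNumber_two_mul (n : ℕ) : waveNumber (2 * n) = n := by simp [waveNumber]

lemma waveNumber_two_mul_sub_one {n : ℕ} (hn : 1 ≤ n) : waveNumber (2 * n - 1) = -n := by
  have h1 : ¬ Even (2 * n - 1) := by rw [Nat.even_iff]; omega
  have h2 : (2 * n - 1 + 1) / 2 = n := by omega
  rw [waveNumber, if_neg h1, h2]

lemma waveNumber_eq (k : ℕ) :
    waveNumber k = ((k + 1) / 2 : ℕ) ∨ waveNumber k = -((k + 1) / 2 : ℕ) := by
  rw [waveNumber]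
  split_ifs with h
  · left
    rw [Nat.even_iff] at h
    congr 1
    omega
  · right; rfl

/-- Bloch waves are determined by their sign and their frequency modulo `2p`. -/
lemma eq_of_waveSign_eq_of_dvd {p k l : ℕ} (hk : k < 4 * p) (hl : l < 4 * p)
    (hs : waveSign p k = waveSign p l) (h : (2 * p : ℤ) ∣ waveNumber l - waveNumber k) : k = l := by
  have hs' : k < 2 * p ↔ l < 2 * p := by
    simp only [waveSign] at hs
    split_ifs at hs with h1 h2 h2
    · simp [h1, h2]
    · norm_num at hs
    · norm_num at hs
    · simp [h1, h2]
  obtain ⟨q, hq⟩ := h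
  -- The frequencies run through `0, -1, 1, -2, 2, …`. Each half of the index range meets every
  -- residue modulo `2 * p` once, so the rest is a bounded integer check.
  have hb : ∀ i : ℕ, i < 4 * p → (i % 2 = 0 ∧ 2 * waveNumber i = i) ∨
      (i % 2 = 1 ∧ 2 * waveNumber i = -(i + 1)) := by
    intro i _
    rw [waveNumber]
    split_ifs with h
    · rw [Nat.even_iff] at h; left; omega
    · rw [Nat.even_iff] at h; right; omega
  have hqb : -2 < q ∧ q < 2 := by
    constructor
    · by_contra hcon
      have : (2 * p : ℤ) * q ≤ 2 * p * (-2) :=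
        mul_le_mul_of_nonneg_left (by omega) (by omega)
      rcases hb k hk with h | h <;> rcases hb l hl with h' | h' <;> omega
    · by_contra hcon
      have : (2 * p : ℤ) * 2 ≤ 2 * p * q :=
        mul_le_mul_of_nonneg_left (by omega) (by omega)
      rcases hb k hk with h | h <;> rcases hb l hl with h' | h' <;> omega
  obtain rfl | rfl | rfl : q = -1 ∨ q = 0 ∨ q = 1 := by omega
  all_goals rcases hb k hk with h | h <;> rcases hb l hl with h' | h' <;> omega

/-- The normalised Bloch waves. -/
noncomputable def blochVector (c : ℝ) (p : ℕ) (k : Fin (4 * p)) :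
    EuclideanSpace ℂ (Fin (4 * p)) :=
  (((√(4 * p))⁻¹ : ℝ) : ℂ) •
    WithLp.toLp 2 fun i : Fin (4 * p) => blochWave c p (waveNumber k) (waveSign p k) i

lemma inner_blochVector (c : ℝ) (p : ℕ) (d : ℤ → ℝ) (k l : Fin (4 * p)) :
    ⟪blochVector c p k, complexOperator (diagonal fun i : Fin (4 * p) => d i) (blochVector c p l)⟫_ℂ
      = 1 / (4 * p) * ∑ j ∈ Finset.range (2 * p), (d (2 * j) + waveSign p k * waveSign p l *
        ((starRingEnd ℂ) (symbolPhase c p (waveNumber k)) * symbolPhase c p (waveNumber l))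
          * d (2 * j + 1)) * unitRoot p ((waveNumber l - waveNumber k) * j) := by
  rw [blochVector, blochVector, map_smul, inner_smul_left, inner_smul_right,
    inner_complexOperator_diagonal, sum_mul_conj_blochWave_mul, ← mul_assoc, Complex.conj_ofReal,
    ← Complex.ofReal_mul, ← mul_inv, Real.mul_self_sqrt (by positivity)]
  push_cast
  rw [one_div]

lemma blochVector_orthonormal (c : ℝ) {p : ℕ} (hp : 0 < p) : Orthonormal ℂ (blochVector c p) := by
  have hp' : (p : ℂ) ≠ 0 := by exact_mod_cast hp.ne'
  rw [orthonormal_iff_ite]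
  intro k l
  have h := inner_blochVector c p (fun _ => 1) k l
  rw [diagonal_one] at h
  have h1 : complexOperator (1 : Matrix (Fin (4 * p)) (Fin (4 * p)) ℝ) = LinearMap.id := by
    rw [complexOperator, Matrix.map_one _ (map_zero _) (map_one _), toLpLin_one]
  rw [h1, LinearMap.id_apply, ← Finset.mul_sum, sum_unitRoot_mul hp] at h
  rw [h]
  by_cases hkl : k = l
  · subst hkl
    have h2 : (waveSign p k : ℂ) * waveSign p k = 1 := by exact_mod_cast waveSign_mul_self p k
    rw [if_pos (by simp), if_pos rfl, h2, conj_symbolPhase_mul_self]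
    push_cast
    field_simp
    norm_num
  · rw [if_neg hkl]
    split_ifs with hdvd
    -- Distinct waves of equal frequency modulo `2 * p` have opposite signs, so the contributions of
    -- even and odd sites cancel.
    · have hne : waveSign p k ≠ waveSign p l := fun hs =>
        hkl (Fin.ext (eq_of_waveSign_eq_of_dvd k.2 l.2 hs hdvd))
      have h2 : waveSign p k * waveSign p l = -1 := by
        simp only [waveSign] at hne ⊢
        split_ifs at hne ⊢ <;> simp_all
      have h3 : (waveSign p k : ℂ) * waveSign p l = -1 := by exact_mod_cast h2
      obtain ⟨q, hq⟩ := hdvd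
      have h4 : symbolPhase c p (waveNumber l) = symbolPhase c p (waveNumber k) := by
        have : symbol c p (waveNumber l) = symbol c p (waveNumber k) := by
          rw [symbol, symbol, unitRoot_congr hp (t := waveNumber k) q (by linarith)]
        rw [symbolPhase, symbolPhase, this]
      rw [h3, h4, conj_symbolPhase_mul_self]
      simp
    · simp

/-- The eigenvalue of the `k`-th Bloch wave. -/
noncomputable def blochEnergy (c : ℝ) (p k : ℕ) : ℝ :=
  waveSign p k * ‖symbol c p ((k + 1) / 2 : ℕ)‖

lemma complexOperator_blochVector (c : ℝ) {p : ℕ} (hp : 0 < p) (k : Fin (4 * p)) :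
    complexOperator (periodicMatrix c 0 (4 * p)) (blochVector c p k)
      = (blochEnergy c p k : ℂ) • blochVector c p k := by
  rw [blochVector, map_smul, smul_comm, complexOperator_periodicMatrix c (by omega)
    (blochWave_periodic c hp _ _)]
  congr 1
  have hn : ‖symbol c p ((k + 1) / 2 : ℕ)‖ = ‖symbol c p (waveNumber k)‖ := by
    rcases waveNumber_eq k with h | h
    · rw [h]
    · rw [h, norm_symbol_neg]
  ext i
  simp only [jacobi_blochWave c p _ (waveSign_mul_self p k), blochEnergy, hn, PiLp.smul_apply,
    smul_eq_mul]

/-- Within one sign this is monotonicity of the modulus on `[0, p]` or `[p, 2p]`. Across signs, at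
most one of the two levels is `p`, the only place where the symbol can vanish, so the inequality
stays strict. -/
lemma blochEnergy_lt {c : ℝ} (hc : c ≠ 0) {p : ℕ} (hp : 0 < p) {k l : ℕ} (hl : l < 4 * p)
    (hkl : (k + 1) / 2 < (l + 1) / 2) : blochEnergy c p k < blochEnergy c p l := by
  rw [blochEnergy, blochEnergy, waveSign, waveSign]
  split_ifs with h1 h2 h2
  · have := norm_symbol_strictAnti hc hp (s := ((k + 1) / 2 : ℕ)) (t := ((l + 1) / 2 : ℕ))
      (by omega) (by omega) (by omega)
    linarith
  · have h3 := norm_nonneg (symbol c p ((k + 1) / 2 : ℕ))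
    have h4 := norm_nonneg (symbol c p ((l + 1) / 2 : ℕ))
    by_cases hk : (k + 1) / 2 = p
    · have := norm_symbol_pos hc hp (s := ((l + 1) / 2 : ℕ)) (by omega) (by omega) (by omega)
      linarith
    · have := norm_symbol_pos hc hp (s := ((k + 1) / 2 : ℕ)) (by omega) (by omega) (by omega)
      linarith
  · omega
  · have := norm_symbol_strictMono hc hp (s := ((k + 1) / 2 : ℕ)) (t := ((l + 1) / 2 : ℕ))
      (by omega) (by omega) (by omega)
    linarith

end BlochWaves

/-! ### Fourier coefficients as sums over the doubled period. -/

section PeriodicSums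

lemma sum_range_add_of_periodic {p : ℕ} {G : ℕ → ℂ} (hG : ∀ j, G (j + p) = G j) (r : ℕ) :
    ∑ j ∈ Finset.range p, G (j + r) = ∑ j ∈ Finset.range p, G j := by
  induction r with
  | zero => rfl
  | succ r ih =>
    have h1 := Finset.sum_range_succ (fun j => G (j + r)) p
    have h2 := Finset.sum_range_succ' (fun j => G (j + r)) p
    have h3 : G (p + r) = G (0 + r) := by rw [add_comm p r, hG, zero_add]
    have h4 : ∀ j, G (j + 1 + r) = G (j + (r + 1)) := fun j => by congr 1; ring
    simp only [h4] at h2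
    rw [← ih]
    linear_combination h1 - h2 + h3

lemma sum_Icc_one_of_periodic {p : ℕ} {G : ℕ → ℂ} (hG : ∀ j, G (j + p) = G j) :
    ∑ j ∈ Finset.Icc 1 p, G j = ∑ j ∈ Finset.range p, G j := by
  rw [← sum_range_add_of_periodic hG 1, ← Finset.Ico_add_one_right_eq_Icc,
    Finset.sum_Ico_eq_sum_range]
  simp [add_comm]

lemma sum_range_two_mul_of_periodic {p : ℕ} {G : ℕ → ℂ} (hG : ∀ j, G (j + p) = G j) :
    ∑ j ∈ Finset.range (2 * p), G j = 2 * ∑ j ∈ Finset.Icc 1 p, G j := by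
  rw [sum_Icc_one_of_periodic hG, two_mul, Finset.sum_range_add]
  simp_rw [add_comm p, hG]
  ring

lemma tau_pow_two_mul {p : ℕ} (hp : 0 < p) (n : ℕ) : tau p n ^ (2 * p) = 1 := by
  rw [← unitRoot_natCast, ← unitRoot_mul_natCast,
    show (n : ℤ) * (2 * p : ℕ) = 2 * p * n by push_cast; ring, unitRoot_two_mul_mul hp]

lemma fourier_summand_periodic {p : ℕ} (hp : 0 < p) {v : ℤ → ℝ} (hv : ∀ n, v (n + 2 * p) = v n)
    (r : ℤ) (n j : ℕ) :
    (v (2 * (j + p : ℕ) + r) : ℂ) * tau p n ^ (2 * (j + p))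
      = (v (2 * j + r) : ℂ) * tau p n ^ (2 * j) := by
  rw [mul_add, pow_add, tau_pow_two_mul hp, mul_one,
    show (2 * (j + p : ℕ) + r : ℤ) = 2 * j + r + 2 * p by push_cast; ring, hv]

lemma vHat0_eq {p : ℕ} (hp : 0 < p) {v : ℤ → ℝ} (hv : ∀ n, v (n + 2 * p) = v n) (n : ℕ) :
    vHat0 p v n
      = 1 / (4 * p) * ∑ j ∈ Finset.range (2 * p), (v (2 * j) : ℂ) * tau p n ^ (2 * j) := by
  rw [sum_range_two_mul_of_periodic fun j => by
    simpa using fourier_summand_periodic hp hv 0 n j]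
  rw [vHat0, fourierCoeffP]
  ring

lemma vHat1_eq {p : ℕ} (hp : 0 < p) {v : ℤ → ℝ} (hv : ∀ n, v (n + 2 * p) = v n) (n : ℕ) :
    vHat1 p v n
      = 1 / (4 * p) * ∑ j ∈ Finset.range (2 * p), (v (2 * j + 1) : ℂ) * tau p n ^ (2 * j) := by
  rw [sum_range_two_mul_of_periodic fun j => fourier_summand_periodic hp hv 1 n j]
  rw [vHat1, fourierCoeffP]
  ring

/-- Over one period of odd length the odd sites are a shift of the even sites. -/
lemma vHat0_eq_tau_pow_mul_vHat1 {p : ℕ} (hp : Odd p) {v : ℤ → ℝ} (hv : ∀ n, v (n + p) = v n)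
    (n : ℕ) : vHat0 p v n = tau p n ^ (p + 1) * vHat1 p v n := by
  have hv2 : ∀ n, v (n + 2 * p) = v n := fun n => by rw [two_mul, ← add_assoc, hv, hv]
  have h0 : ∀ j : ℕ, (v (2 * (j + p : ℕ)) : ℂ) * tau p n ^ (2 * (j + p))
      = (v (2 * j) : ℂ) * tau p n ^ (2 * j) := fun j => by
    simpa using fourier_summand_periodic hp.pos hv2 0 n j
  have h1 : ∀ j : ℕ, (v (2 * (j + p : ℕ) + 1) : ℂ) * tau p n ^ (2 * (j + p))
      = (v (2 * j + 1) : ℂ) * tau p n ^ (2 * j) := fun j =>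
    fourier_summand_periodic hp.pos hv2 1 n j
  rw [vHat0, vHat1, fourierCoeffP, fourierCoeffP, sum_Icc_one_of_periodic h0,
    sum_Icc_one_of_periodic h1, ← mul_assoc, mul_comm (tau p n ^ (p + 1)), mul_assoc]
  congr 1
  obtain ⟨r, hr⟩ := hp
  -- With `p = 2 * r + 1`, shifting `j` by `r + 1` moves the even site `2 * j` to `2 * j + 1 + p`,
  -- which is the odd site `2 * j + 1` modulo `p`.
  rw [← sum_range_add_of_periodic h0 (r + 1), Finset.mul_sum]
  refine Finset.sum_congr rfl fun j _ => ?_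
  rw [← hv (2 * j + 1), show (2 * (j + (r + 1) : ℕ) : ℤ) = 2 * j + 1 + p by rw [hr]; push_cast; ring,
    show 2 * (j + (r + 1)) = 2 * j + (p + 1) by omega, pow_add]
  ring

end PeriodicSums

/-! ### Odd periods and the zeros of `ρ_n`. -/

section OddPeriod

lemma norm_tau (p n : ℕ) : ‖tau p n‖ = 1 := by
  rw [← unitRoot_natCast, unitRoot_eq_exp_ofReal, Complex.norm_exp_ofReal_mul_I]

lemma tau_pow_self {p : ℕ} (hp : 0 < p) (n : ℕ) : tau p n ^ p = (-1) ^ n := by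
  rw [← unitRoot_natCast, ← unitRoot_mul_natCast, mul_comm, unitRoot_mul_natCast, unitRoot_self hp]

lemma tau_self {p : ℕ} (hp : 0 < p) : tau p p = -1 := by
  rw [← unitRoot_natCast, unitRoot_self hp]

lemma tau_ne_one {p n : ℕ} (hn : 1 ≤ n) (hn' : n ≤ 2 * p - 1) : tau p n ≠ 1 := by
  rw [← unitRoot_natCast, Ne, unitRoot_eq_one_iff (by omega)]
  intro h
  have := Int.le_of_dvd (by omega) h
  omega

lemma tau_ne_neg_one {p n : ℕ} (hn : 1 ≤ n) (hn' : n ≤ 2 * p - 1) (hnp : n ≠ p) :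
    tau p n ≠ -1 := by
  have hp : 0 < p := by omega
  intro h
  have h1 : unitRoot p (n - p) = 1 := by
    rw [unitRoot_congr hp (t := n + p) (-1) (by ring), unitRoot_add, unitRoot_natCast, h,
      unitRoot_self hp]
    norm_num
  obtain ⟨q, hq⟩ := (unitRoot_eq_one_iff hp _).1 h1
  have hq1 : q < 1 := by
    by_contra hcon
    have : (2 * p : ℤ) * 1 ≤ 2 * p * q := mul_le_mul_of_nonneg_left (by omega) (by omega)
    omega
  have hq2 : -1 < q := by
    by_contra hcon
    have : (2 * p : ℤ) * q ≤ 2 * p * (-1) := mul_le_mul_of_nonneg_left (by omega) (by omega)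
    omega
  obtain rfl : q = 0 := by omega
  omega

lemma tau_mul_conj (p n : ℕ) : tau p n * (starRingEnd ℂ) (tau p n) = 1 := by
  rw [Complex.mul_conj', norm_tau]
  simp

lemma symbol_natCast (c : ℝ) (p n : ℕ) :
    symbol c p n = 2 * ((|c| : ℝ) : ℂ) + tau p n := by
  rw [symbol, unitRoot_natCast]

lemma symbol_natCast_ne_zero {c : ℝ} (hc : c ≠ 0) {p n : ℕ} (hn' : n ≤ 2 * p - 1)
    (hn : 1 ≤ n) (hnp : n ≠ p) : symbol c p n ≠ 0 :=
  norm_pos_iff.1 (norm_symbol_pos hc (by omega) (by omega) (by omega) (by exact_mod_cast hnp))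

lemma phase_mul_conj_symbol {c : ℝ} {p n : ℕ} (h : symbol c p n ≠ 0) :
    phase c p n * (starRingEnd ℂ) (symbol c p n) = symbol c p n := by
  rw [phase_eq_symbolPhase_sq h]
  linear_combination symbolPhase c p n * symbolPhase_mul_conj_symbol c p n
    + norm_mul_symbolPhase c p n

lemma tau_mul_conj_symbol (c : ℝ) (p n : ℕ) :
    tau p n * (starRingEnd ℂ) (symbol c p n) = 2 * ((|c| : ℝ) : ℂ) * tau p n + 1 := by
  rw [symbol_natCast]
  simp only [map_add, map_mul, Complex.conj_ofReal, Complex.conj_ofNat]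
  linear_combination tau_mul_conj p n

/-- Multiplying by the nonzero conjugate symbol removes the phase and leaves an expression of degree
one in `τ_n`, which factorises for either parity of `n`. -/
lemma rho_eq_zero_iff {c : ℝ} (hc : c ≠ 0) {p n : ℕ} (hn : 1 ≤ n) (hn' : n ≤ 2 * p - 1)
    (hnp : n ≠ p) : rho c p n = 0 ↔
      (-1) ^ n * (2 * ((|c| : ℝ) : ℂ) * tau p n + 1) + (2 * ((|c| : ℝ) : ℂ) + tau p n) = 0 := by
  have hz := symbol_natCast_ne_zero hc hn' hn hnp
  have hz' : (starRingEnd ℂ) (symbol c p n) ≠ 0 := by simpa using hz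
  rw [rho, if_neg hnp, norm_eq_zero, ← mul_left_inj' hz', zero_mul, add_mul,
    phase_mul_conj_symbol hz, mul_assoc, tau_mul_conj_symbol, symbol_natCast]

lemma rho_ne_zero_of_even {c : ℝ} (hc : c ≠ 0) {p n : ℕ} (hn : 1 ≤ n) (hn' : n ≤ 2 * p - 1)
    (hnp : n ≠ p) (he : Even n) : rho c p n ≠ 0 := by
  rw [Ne, rho_eq_zero_iff hc hn hn' hnp, he.neg_one_pow]
  intro h
  have h1 : (2 * ((|c| : ℝ) : ℂ) + 1) * (tau p n + 1) = 0 := by linear_combination h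
  rcases mul_eq_zero.1 h1 with h2 | h2
  · have : 2 * |c| + 1 = 0 := by exact_mod_cast h2
    linarith [abs_nonneg c]
  · exact tau_ne_neg_one hn hn' hnp (eq_neg_of_add_eq_zero_left h2)

lemma rho_eq_zero_iff_of_odd {c : ℝ} (hc : c ≠ 0) {p n : ℕ} (hn : 1 ≤ n) (hn' : n ≤ 2 * p - 1)
    (hnp : n ≠ p) (ho : Odd n) : rho c p n = 0 ↔ |c| = 1 / 2 := by
  rw [rho_eq_zero_iff hc hn hn' hnp, ho.neg_one_pow]
  constructor
  · intro h
    have h1 : (2 * ((|c| : ℝ) : ℂ) - 1) * (1 - tau p n) = 0 := by linear_combination h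
    rcases mul_eq_zero.1 h1 with h2 | h2
    · have : 2 * |c| - 1 = 0 := by exact_mod_cast h2
      linarith
    · exact absurd (sub_eq_zero.1 h2).symm (tau_ne_one hn hn')
  · intro h
    rw [h]
    push_cast
    ring

/-- The coefficients differ by `τ_n ^ (p + 1) = (-1) ^ n * τ_n`, of modulus one. For `n = p` this
factor is `1`, since `p + 1` is even, and the difference vanishes. -/
lemma psi_eq_norm_mul_rho {c : ℝ} {p : ℕ} (hp : Odd p) {v : ℤ → ℝ} (hv : ∀ n, v (n + p) = v n)
    (n : ℕ) : psi c p v n = ‖vHat0 p v n‖ * rho c p n := by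
  have h := vHat0_eq_tau_pow_mul_vHat1 hp hv n
  rw [psi, rho]
  split_ifs with hnp
  · subst hnp
    rw [h, tau_self hp.pos, hp.add_one.neg_one_pow]
    simp
  · rw [h, pow_succ, tau_pow_self hp.pos, ← add_mul, norm_mul, norm_mul, norm_mul, norm_pow,
      norm_neg, norm_one, one_pow, norm_tau]
    ring

end OddPeriod

/-! ### Matrix elements of the potential and expansion of the edges. -/

section Edges

open Matrix

variable {c : ℝ} {p : ℕ} {v : ℤ → ℝ}

/-- Bloch waves have constant modulus, so the diagonal element is the mean of `v`. -/
lemma inner_blochVector_self (hv : ∀ n, v (n + 2 * p) = v n)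
    (hv0 : ∑ n ∈ Finset.Icc 1 (2 * p), v n = 0) (k : Fin (4 * p)) :
    ⟪blochVector c p k, complexOperator (diagonal fun i : Fin (4 * p) => v i)
      (blochVector c p k)⟫_ℂ = 0 := by
  have h1 : (waveSign p k : ℂ) * waveSign p k = 1 := by exact_mod_cast waveSign_mul_self p k
  have h2 := sum_range_two_mul (fun i : ℕ => (v i : ℂ)) (2 * p)
  rw [sum_range_two_mul_of_periodic (p := 2 * p) fun j => by push_cast; rw [hv]] at h2
  have h3 : ∑ n ∈ Finset.Icc 1 (2 * p), (v (n : ℕ) : ℂ) = 0 := by exact_mod_cast hv0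
  rw [h3, mul_zero] at h2
  rw [inner_blochVector, h1, conj_symbolPhase_mul_self, sub_self]
  simp only [one_mul, zero_mul, unitRoot_zero, mul_one]
  push_cast at h2
  rw [← h2, mul_zero]

/-- The matrix element of the potential between the two Bloch waves at the `n`-th gap. -/
lemma norm_inner_blochVector (hc : c ≠ 0) (hv : ∀ n, v (n + 2 * p) = v n) {n : ℕ} (hn : 1 ≤ n)
    (hn' : n ≤ 2 * p - 1) (hnp : n = p → 2 * |c| = 1) (k l : Fin (4 * p))
    (hk : (k : ℕ) = 2 * n - 1) (hl : (l : ℕ) = 2 * n) :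
    ‖⟪blochVector c p k, complexOperator (diagonal fun i : Fin (4 * p) => v i)
      (blochVector c p l)⟫_ℂ‖ = psi c p v n := by
  have hp : 0 < p := by omega
  have hroot : ∀ j : ℕ, unitRoot p (((n : ℤ) - -n) * j) = tau p n ^ (2 * j) := by
    intro j
    rw [← unitRoot_natCast, ← unitRoot_mul_natCast]
    congr 1
    push_cast
    ring
  have key : ∀ κ : ℂ, 1 / (4 * (p : ℂ)) * ∑ j ∈ Finset.range (2 * p),
      ((v (2 * j) : ℂ) + κ * v (2 * j + 1)) * tau p n ^ (2 * j)
      = vHat0 p v n + κ * vHat1 p v n := by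
    intro κ
    rw [vHat0_eq hp hv, vHat1_eq hp hv]
    simp only [add_mul, Finset.sum_add_distrib, mul_assoc, ← Finset.mul_sum]
    ring
  rw [inner_blochVector, hk, hl, waveNumber_two_mul_sub_one hn, waveNumber_two_mul]
  simp only [hroot, conj_symbolPhase, neg_neg]
  rw [key, psi]
  split_ifs with h
  -- When the middle gap closes the symbol vanishes and both phases are `1` by convention. The pair
  -- straddles the change of sign at index `2 * p`, which produces the minus in `ψ_p`.
  · have h1 : symbol c p n = 0 := by
      rw [symbol_natCast, h, tau_self hp]
      have : (2 : ℂ) * ((|c| : ℝ) : ℂ) = 1 := by exact_mod_cast hnp h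
      rw [this]
      ring
    have h2 : waveSign p (2 * n - 1) = -1 := if_pos (by omega)
    have h3 : waveSign p (2 * n) = 1 := if_neg (by omega)
    rw [h2, h3, symbolPhase, if_pos h1, h]
    congr 1
    push_cast
    ring
  -- Away from the middle both waves have the same sign. Conjugating the phase at `-n` gives the
  -- phase at `n`, so the relative factor is its square.
  · have h1 : waveSign p (2 * n - 1) = waveSign p (2 * n) := by
      rw [waveSign, waveSign]
      congr 1
      rw [eq_iff_iff]
      omega
    have h2 : (waveSign p (2 * n) : ℂ) * waveSign p (2 * n) = 1 := by
      exact_mod_cast waveSign_mul_self p _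
    rw [h1, h2, one_mul, phase_eq_symbolPhase_sq (symbol_natCast_ne_zero hc hn' hn h), sq]

lemma periodicEigenvalues_getD (c : ℝ) (v : ℤ → ℝ) (p k : ℕ) (t : ℝ) :
    (periodicEigenvalues c (fun m => t * v m) (4 * p)).getD k 0
      = ((periodicMatrix c 0 (4 * p) + t • diagonal fun i : Fin (4 * p) => v i).charpoly.roots.sort
        (· ≤ ·)).getD k 0 := by
  rw [periodicEigenvalues, periodicMatrix_smul]

lemma diagonal_isHermitian (v : ℤ → ℝ) (m : ℕ) :
    (diagonal fun i : Fin m => v i).IsHermitian :=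
  isHermitian_diagonal _

/-- Expansion of the two edges of the `n`-th gap, when it is closed for the unperturbed operator. -/
lemma exists_edges_sub_le (hc : c ≠ 0) (hv : ∀ n, v (n + 2 * p) = v n)
    (hv0 : ∑ n ∈ Finset.Icc 1 (2 * p), v n = 0) {n : ℕ} (hn : n ∈ admissible c p) :
    (∃ K, ∃ t₀ > 0, ∀ t : ℝ, 0 ≤ t → t ≤ t₀ →
      |zMinus c (fun m => t * v m) p n - (blochEnergy c p (2 * n) - t * psi c p v n)|
        ≤ K * t ^ 2) ∧
    (∃ K, ∃ t₀ > 0, ∀ t : ℝ, 0 ≤ t → t ≤ t₀ →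
      |zPlus c (fun m => t * v m) p n - (blochEnergy c p (2 * n) + t * psi c p v n)|
        ≤ K * t ^ 2) := by
  obtain ⟨hn1, hn2, hnp⟩ := hn
  have hp : 0 < p := by omega
  set k : Fin (4 * p) := ⟨2 * n - 1, by omega⟩ with hk
  set l : Fin (4 * p) := ⟨2 * n, by omega⟩ with hl
  have hek : blochEnergy c p k = blochEnergy c p l := by
    have h1 : ((k : ℕ) + 1) / 2 = n := by simp only [hk]; omega
    have h2 : ((l : ℕ) + 1) / 2 = n := by simp only [hl]; omega
    rw [blochEnergy, blochEnergy, h1, h2]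
    by_cases h : n = p
    · rw [h, norm_symbol_self c hp, hnp h]
      simp
    · congr 1
      rw [waveSign, waveSign]
      congr 1
      simp only [hk, hl, eq_iff_iff]
      omega
  have := exists_sort_roots_sub_le_of_double (periodicMatrix_isHermitian c p)
    (diagonal_isHermitian v (4 * p)) (blochVector_orthonormal c hp) (fun i => blochEnergy c p i)
    (complexOperator_blochVector c hp) k l (Fin.mk_lt_mk.2 (by omega)) hek
    (fun i hi => blochEnergy_lt hc hp k.2 (by
      have := Fin.lt_def.1 hi; simp only [hk] at this ⊢; omega))
    (fun i hi => blochEnergy_lt hc hp i.2 (by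
      have := Fin.lt_def.1 hi; simp only [hk, hl] at this ⊢; omega))
    (fun i hi hi' => by
      have h1 := Fin.le_def.1 hi; have h2 := Fin.le_def.1 hi'
      simp only [hk, hl, Fin.ext_iff] at h1 h2 ⊢; omega)
    (inner_blochVector_self hv hv0 k) (inner_blochVector_self hv hv0 l)
  rw [norm_inner_blochVector hc hv hn1 hn2 hnp k l rfl rfl] at this
  simp only [hek] at this
  simp only [zMinus, zPlus, periodicEigenvalues_getD]
  exact this

/-- Expansion of a simple eigenvalue. -/
lemma exists_simple_edge_sub_le (hp : 0 < p) (hv : ∀ n, v (n + 2 * p) = v n)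
    (hv0 : ∑ n ∈ Finset.Icc 1 (2 * p), v n = 0) {k : ℕ} (hk : k < 4 * p)
    (hlt : ∀ i < k, blochEnergy c p i < blochEnergy c p k)
    (hgt : ∀ i, k < i → i < 4 * p → blochEnergy c p k < blochEnergy c p i) :
    ∃ K, ∃ t₀ > 0, ∀ t : ℝ, 0 ≤ t → t ≤ t₀ →
      |(periodicEigenvalues c (fun m => t * v m) (4 * p)).getD k 0
        - (blochEnergy c p k + t * 0)| ≤ K * t ^ 2 := by
  have := exists_sort_roots_sub_le_of_simple (periodicMatrix_isHermitian c p)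
    (diagonal_isHermitian v (4 * p)) (blochVector_orthonormal c hp) (fun i => blochEnergy c p i)
    (complexOperator_blochVector c hp) ⟨k, hk⟩ (fun i hi => hlt i hi) (fun i hi => hgt i hi i.2)
    (inner_blochVector_self hv hv0 _)
  simpa only [periodicEigenvalues_getD, mul_zero, add_zero] using this

/-- The bound includes `t = 0`, where it forces the exact unperturbed value; the same estimate thus
yields both the edges at zero and their expansion. -/
lemma eq_and_isBigO_of_exists_bound {F : ℝ → ℝ} {e g : ℝ}
    (h : ∃ K, ∃ t₀ > 0, ∀ t : ℝ, 0 ≤ t → t ≤ t₀ → |F t - (e + t * g)| ≤ K * t ^ 2) :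
    F 0 = e ∧ (fun t => F t - (F 0 + t * g)) =O[𝓝[>] 0] fun t => t ^ 2 := by
  obtain ⟨K, t₀, ht₀, hK⟩ := h
  have h0 : F 0 = e := by
    have := hK 0 le_rfl ht₀.le
    norm_num at this
    linarith
  refine ⟨h0, IsBigO.of_bound K ?_⟩
  filter_upwards [Ioo_mem_nhdsGT ht₀] with t ht
  rw [h0, Real.norm_eq_abs, Real.norm_eq_abs, abs_of_nonneg (sq_nonneg t)]
  exact hK t ht.1.le ht.2.le

end Edges

/-! ### Unperturbed edges and asymptotics, case by case. -/

section Edges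

variable {c : ℝ} {p : ℕ} {v : ℤ → ℝ}

lemma zMinus_zero_and_isBigO (hc : c ≠ 0) (hv : ∀ n, v (n + 2 * p) = v n)
    (hv0 : ∑ n ∈ Finset.Icc 1 (2 * p), v n = 0) {n : ℕ} (hn : n ∈ admissible c p) :
    zMinus c 0 p n = blochEnergy c p (2 * n) ∧
    (fun t : ℝ => zMinus c (fun m => t * v m) p n - (zMinus c 0 p n - t * psi c p v n))
      =O[𝓝[>] 0] fun t => t ^ 2 := by
  have h := (exists_edges_sub_le hc hv hv0 hn).1
  simp only [sub_eq_add_neg (blochEnergy _ _ _), ← mul_neg] at h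
  simpa [sub_eq_add_neg, Pi.zero_def] using eq_and_isBigO_of_exists_bound h

lemma zPlus_zero_and_isBigO (hc : c ≠ 0) (hv : ∀ n, v (n + 2 * p) = v n)
    (hv0 : ∑ n ∈ Finset.Icc 1 (2 * p), v n = 0) {n : ℕ} (hn : n ∈ admissible c p) :
    zPlus c 0 p n = blochEnergy c p (2 * n) ∧
    (fun t : ℝ => zPlus c (fun m => t * v m) p n - (zPlus c 0 p n + t * psi c p v n))
      =O[𝓝[>] 0] fun t => t ^ 2 := by
  simpa [Pi.zero_def] using eq_and_isBigO_of_exists_bound (exists_edges_sub_le hc hv hv0 hn).2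

lemma simple_edge_zero_and_isBigO (hp : 0 < p) (hv : ∀ n, v (n + 2 * p) = v n)
    (hv0 : ∑ n ∈ Finset.Icc 1 (2 * p), v n = 0) {k : ℕ} (hk : k < 4 * p)
    (hlt : ∀ i < k, blochEnergy c p i < blochEnergy c p k)
    (hgt : ∀ i, k < i → i < 4 * p → blochEnergy c p k < blochEnergy c p i) :
    (periodicEigenvalues c 0 (4 * p)).getD k 0 = blochEnergy c p k ∧
    (fun t : ℝ => (periodicEigenvalues c (fun m => t * v m) (4 * p)).getD k 0
      - (periodicEigenvalues c 0 (4 * p)).getD k 0) =O[𝓝[>] 0] fun t => t ^ 2 := by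
  simpa only [zero_mul, mul_zero, add_zero, ← Pi.zero_def] using
    eq_and_isBigO_of_exists_bound (exists_simple_edge_sub_le hp hv hv0 hk hlt hgt)

lemma blochEnergy_two_mul (c : ℝ) {p n : ℕ} (hnp : n ≠ p) :
    blochEnergy c p (2 * n)
      = ‖2 * ((|c| : ℝ) : ℂ) + tau p n‖ * SignType.sign ((n : ℝ) - p) := by
  have h1 : (2 * n + 1) / 2 = n := by omega
  rw [blochEnergy, h1, symbol_natCast, waveSign, mul_comm]
  rcases lt_or_gt_of_ne hnp with h | h
  · have h2 : (n : ℝ) - p < 0 := by rw [sub_neg]; exact_mod_cast h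
    rw [if_pos (by omega), sign_neg h2]
    simp
  · have h2 : 0 < (n : ℝ) - p := by rw [sub_pos]; exact_mod_cast h
    rw [if_neg (by omega), sign_pos h2]
    simp

lemma blochEnergy_middle (c : ℝ) {p : ℕ} (hp : 0 < p) :
    blochEnergy c p (2 * p - 1) = -|2 * |c| - 1| ∧ blochEnergy c p (2 * p) = |2 * |c| - 1| := by
  have h1 : (2 * p - 1 + 1) / 2 = p := by omega
  have h2 : (2 * p + 1) / 2 = p := by omega
  rw [blochEnergy, blochEnergy, h1, h2, norm_symbol_self c hp, waveSign, waveSign,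
    if_pos (by omega), if_neg (by omega)]
  simp

/-- The symbol does not vanish at frequency `p`, so the middle gap is already open and both its
edges are simple. -/
lemma middle_edges_zero_and_isBigO (hc : c ≠ 0) (hc1 : 2 * |c| ≠ 1) (hp : 0 < p)
    (hv : ∀ n, v (n + 2 * p) = v n) (hv0 : ∑ n ∈ Finset.Icc 1 (2 * p), v n = 0) :
    (zMinus c 0 p p = -|2 * |c| - 1| ∧
      (fun t : ℝ => zMinus c (fun m => t * v m) p p - zMinus c 0 p p)
        =O[𝓝[>] 0] fun t => t ^ 2) ∧
    (zPlus c 0 p p = |2 * |c| - 1| ∧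
      (fun t : ℝ => zPlus c (fun m => t * v m) p p - zPlus c 0 p p)
        =O[𝓝[>] 0] fun t => t ^ 2) := by
  obtain ⟨h1, h2⟩ := blochEnergy_middle c hp
  have hlt : blochEnergy c p (2 * p - 1) < blochEnergy c p (2 * p) := by
    have : 0 < |2 * |c| - 1| := abs_pos.2 (sub_ne_zero.2 hc1)
    rw [h1, h2]
    linarith
  have h3 : ∀ i, i ≠ 2 * p - 1 → i < 2 * p → blochEnergy c p i < blochEnergy c p (2 * p - 1) :=
    fun i hi hi' => blochEnergy_lt hc hp (by omega) (by omega)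
  have h4 : ∀ i, 2 * p < i → i < 4 * p → blochEnergy c p (2 * p) < blochEnergy c p i :=
    fun i hi hi' => blochEnergy_lt hc hp hi' (by omega)
  rw [← h1, ← h2]
  constructor
  · refine simple_edge_zero_and_isBigO hp hv hv0 (by omega) (fun i hi => h3 i (by omega) (by omega))
      fun i hi hi' => ?_
    rcases (show 2 * p ≤ i by omega).eq_or_lt with rfl | h
    · exact hlt
    · exact hlt.trans (h4 i h hi')
  · refine simple_edge_zero_and_isBigO hp hv hv0 (by omega) (fun i hi => ?_)
      fun i hi hi' => h4 i hi hi'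
    by_cases h : i = 2 * p - 1
    · rw [h]; exact hlt
    · exact (h3 i h hi).trans hlt

end Edges

theorem theorem3 (N : ℕ) (hN : 1 ≤ N) (k : ℤ) (b : ℝ) (c : ℝ) (hc : c = hopping N k b)
    (hc0 : c ≠ 0) (ps : ℕ) (hps : 1 ≤ ps) (p : ℕ) (hp : p = halfPeriod ps)
    (v : ℤ → ℝ) (hv : ∀ n, v (n + ps) = v n)
    (hv0 : ∑ n ∈ Finset.Icc 1 (2 * p), v n = 0) :
    -- first-order asymptotics of the gap edges
    (∀ n ∈ admissible c p,
      ((fun t : ℝ => zPlus c (fun m => t * v m) p n - (zPlus c 0 p n + t * psi c p v n))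
        =O[𝓝[>] 0] fun t => t ^ 2) ∧
      ((fun t : ℝ => zMinus c (fun m => t * v m) p n - (zMinus c 0 p n - t * psi c p v n))
        =O[𝓝[>] 0] fun t => t ^ 2)) ∧
    -- the extreme edges
    ((fun t : ℝ => zPlus c (fun m => t * v m) p 0 - zPlus c 0 p 0) =O[𝓝[>] 0] fun t => t ^ 2) ∧
    ((fun t : ℝ => zMinus c (fun m => t * v m) p (2 * p) - zMinus c 0 p (2 * p))
      =O[𝓝[>] 0] fun t => t ^ 2) ∧
    -- the middle edges
    (2 * |c| ≠ 1 →
      ((fun t : ℝ => zPlus c (fun m => t * v m) p p - zPlus c 0 p p)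
        =O[𝓝[>] 0] fun t => t ^ 2) ∧
      ((fun t : ℝ => zMinus c (fun m => t * v m) p p - zMinus c 0 p p)
        =O[𝓝[>] 0] fun t => t ^ 2)) ∧
    -- the unperturbed edges
    (∀ n : ℕ, 1 ≤ n → n ≤ 2 * p - 1 → n ≠ p →
      zPlus c 0 p n = ‖2 * ((|c| : ℝ) : ℂ) + tau p n‖ * SignType.sign ((n : ℝ) - p) ∧
      zMinus c 0 p n = ‖2 * ((|c| : ℝ) : ℂ) + tau p n‖ * SignType.sign ((n : ℝ) - p)) ∧
    (zPlus c 0 p p = |2 * |c| - 1| ∧ zMinus c 0 p p = -|2 * |c| - 1|) ∧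
    -- odd periods
    (Odd ps → ∀ n ∈ admissible c p,
      vHat0 p v n = tau p n ^ (p + 1) * vHat1 p v n ∧
      psi c p v n = ‖vHat0 p v n‖ * rho c p n ∧
      (|c| ≠ 1 / 2 → rho c p n ≠ 0) ∧
      (|c| = 1 / 2 → Even n → rho c p n ≠ 0) ∧
      (|c| = 1 / 2 → Odd n → rho c p n = 0)) := by
  have hpp : 0 < p ∧ (ps ∣ 2 * p) ∧ (Odd ps → p = ps) := by
    rw [hp, halfPeriod]
    split_ifs with h
    · obtain ⟨r, hr⟩ := h
      refine ⟨by omega, ⟨1, by omega⟩, fun ho => absurd ho (Nat.not_odd_iff_even.2 ⟨r, hr⟩)⟩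
    · exact ⟨by omega, ⟨2, by omega⟩, fun _ => rfl⟩
  obtain ⟨hp0, ⟨q, hq⟩, hodd⟩ := hpp
  have hv2 : ∀ n, v (n + 2 * p) = v n := by
    intro n
    have hper : Function.Periodic v (ps : ℤ) := hv
    have hq' : (2 * p : ℤ) = q * ps := by rw [mul_comm (q : ℤ)]; exact_mod_cast hq
    rw [hq']
    exact hper.int_mul q n
  refine ⟨fun n hn => ⟨(zPlus_zero_and_isBigO hc0 hv2 hv0 hn).2,
      (zMinus_zero_and_isBigO hc0 hv2 hv0 hn).2⟩, ?_, ?_, fun h => ?_, fun n hn hn' hnp => ?_, ?_,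
      fun ho n hn => ?_⟩
  -- Levels `0` and `2 * p` each contain a single index, `0` and `4 * p - 1`, so the extreme edges
  -- are simple.
  · exact (simple_edge_zero_and_isBigO hp0 hv2 hv0 (by omega) (fun i hi => by omega)
      fun i hi hi' => blochEnergy_lt hc0 hp0 hi' (by omega)).2
  · exact (simple_edge_zero_and_isBigO hp0 hv2 hv0 (k := 2 * (2 * p) - 1) (by omega)
      (fun i hi => blochEnergy_lt hc0 hp0 (by omega) (by omega)) fun i hi hi' => by omega).2
  · have := middle_edges_zero_and_isBigO hc0 h hp0 hv2 hv0
    exact ⟨this.2.2, this.1.2⟩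
  · have hadm : n ∈ admissible c p := ⟨hn, hn', fun h => absurd h hnp⟩
    rw [(zPlus_zero_and_isBigO hc0 hv2 hv0 hadm).1, (zMinus_zero_and_isBigO hc0 hv2 hv0 hadm).1,
      blochEnergy_two_mul c hnp]
    exact ⟨rfl, rfl⟩
  · by_cases h : 2 * |c| = 1
    · have hadm : p ∈ admissible c p := ⟨hp0, by omega, fun _ => h⟩
      rw [(zPlus_zero_and_isBigO hc0 hv2 hv0 hadm).1, (zMinus_zero_and_isBigO hc0 hv2 hv0 hadm).1,
        (blochEnergy_middle c hp0).2, h]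
      simp
    · have := middle_edges_zero_and_isBigO hc0 h hp0 hv2 hv0
      exact ⟨this.2.1, this.1.1⟩
  · obtain rfl := hodd ho
    obtain ⟨hn1, hn2, hnp⟩ := hn
    refine ⟨vHat0_eq_tau_pow_mul_vHat1 ho hv n, psi_eq_norm_mul_rho ho hv n, fun h => ?_,
      fun _ he => ?_, fun h ho' => ?_⟩
    · have hne : n ≠ p := fun hh => h (by linarith [hnp hh])
      rcases Nat.even_or_odd n with he | ho'
      · exact rho_ne_zero_of_even hc0 hn1 hn2 hne he
      · exact fun h0 => h ((rho_eq_zero_iff_of_odd hc0 hn1 hn2 hne ho').1 h0)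
    -- The exceptional index `p` is odd here, so an even `n` avoids it.
    · have hne : n ≠ p := fun hh => Nat.not_odd_iff_even.2 he (hh ▸ ho)
      exact rho_ne_zero_of_even hc0 hn1 hn2 hne he
    · by_cases hne : n = p
      · rw [rho, if_pos hne]
      · exact (rho_eq_zero_iff_of_odd hc0 hn1 hn2 hne ho').2 h
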